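/- All graphs are finite and simple, and $\lambda(G)$ denotes the spectral radius of $G$, i.e. the largest eigenvalue of its adjacency matrix. A graph $H$ is a minor of $G$ if it can be obtained from $G$ by vertex deletions, edge deletions and edge contractions; $G$ is $H$-minor-free if $H$ is not a minor of $G$. Write $G\nabla H$ for the join of $G$ and $H$. For $n\ge t\ge 1$ let $S_{n,t}=K_t\nabla \overline{K}_{n-t}$ and $F_{n,t}=K_t\nabla(pK_2\cup K_q)$, where $n-t=2p+q$ with $q\in\{0,1\}$. For $M\subseteq E(K_r)$ let $K_r-M$ be the graph obtained from $K_r$ by deleting the edges in $M$, and let $K_r[M]$ be the graph whose edges are those in $M$ and whose vertices are the endpoints of the edges in $M$. **Theorem.** Let $r\ge 4$ and let $M\subseteq E(K_r)$ be nonempty. (i) If $M$ is a matching, then there is an $N$ such that every $(K_r-M)$-minor-free graph $G$ on $n\ge N$ vertices satisfies $\lambda(G)\le\lambda(F_{n,r-3})$, with equality if and only if $G\cong F_{n,r-3}$. (ii) If $M$ is not a matching and $K_r[M]$ is connected and triangle-free, then there is an $N$ such that every $(K_r-M)$-minor-free graph $G$ on $n\ge N$ vertices satisfies $\lambda(G)\le\lambda(S_{n,r-3})$,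 with equality if and only if $G\cong S_{n,r-3}$. -/

import Mathlib

namespace MinorSpectral

open SimpleGraph

/-- `H` is a minor of `G`, in branch-set form: there are pairwise disjoint vertex sets `B h`
of `G`, one for each vertex `h` of `H`, each inducing a connected (in particular nonempty)
subgraph of `G`, such that `G` has an edge between `B h` and `B k` whenever `h` and `k` are
adjacent in `H`. For finite graphs this says that `H` arises from `G` by vertex deletions,
edge deletions and edge contractions. -/
def IsMinor {W V : Type*} (H : SimpleGraph W) (G : SimpleGraph V) : Prop :=
  ∃ B : W → Set V,
    (∀ h, (G.induce (B h)).Connected) ∧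
    (∀ h k, h ≠ k → Disjoint (B h) (B k)) ∧
    (∀ h k, H.Adj h k → ∃ x ∈ B h, ∃ y ∈ B k, G.Adj x y)

/-- `G` is `H`-minor-free. -/
def MinorFree {W V : Type*} (H : SimpleGraph W) (G : SimpleGraph V) : Prop :=
  ¬ IsMinor H G

/-- The set of (real) eigenvalues of the adjacency matrix of a finite graph. -/
def adjEigenvalues {V : Type*} [Fintype V] (G : SimpleGraph V) : Set ℝ :=
  open Classical in {μ | Module.End.HasEigenvalue (Matrix.toLin' (G.adjMatrix ℝ)) μ}

/-- The spectral radius `λ(G)`: the largest eigenvalue of the adjacency matrix. -/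
noncomputable def lam {V : Type*} [Fintype V] (G : SimpleGraph V) : ℝ :=
  sSup (adjEigenvalues G)

/-- For a graph with at least one vertex the supremum above is attained, so `lam G` really is
the largest eigenvalue. -/
theorem isGreatest_lam {V : Type*} [Fintype V] [Nonempty V] (G : SimpleGraph V) :
    IsGreatest (adjEigenvalues G) (lam G) := by
  classical
  have hfin : (adjEigenvalues G).Finite := Module.End.finite_hasEigenvalue _
  have hne : (adjEigenvalues G).Nonempty := by
    have hA : (G.adjMatrix ℝ).IsHermitian := by
      rw [Matrix.IsHermitian, Matrix.conjTranspose_eq_transpose_of_trivial]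
      exact G.isSymm_adjMatrix
    obtain ⟨v⟩ := ‹Nonempty V›
    refine ⟨hA.eigenvalues v, ?_⟩
    have h := hA.eigenvalues_mem_spectrum_real v
    rw [← Matrix.spectrum_toLin', ← Module.End.hasEigenvalue_iff_mem_spectrum] at h
    unfold adjEigenvalues
    simp only [Set.mem_ofPred_eq]
    convert h
  exact ⟨hne.csSup_mem hfin, fun x hx => le_csSup hfin.bddAbove hx⟩

/-- The join `G ∇ H`: the disjoint union together with all edges between the two parts. -/
def join {V W : Type*} (G : SimpleGraph V) (H : SimpleGraph W) : SimpleGraph (V ⊕ W) :=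
  (G ⊕g H) ⊔ completeBipartiteGraph V W

/-- `p K₂`: the disjoint union of `p` single edges; the edges join `(i, 0)` and `(i, 1)`. -/
def disjointEdges (p : ℕ) : SimpleGraph (Fin p × Fin 2) :=
  (⊥ : SimpleGraph (Fin p)) □ (⊤ : SimpleGraph (Fin 2))

/-- `S_{n,t} = K_t ∇ (complement of K_{n-t})`, a graph on `n` vertices (for `t ≤ n`). -/
def S (n t : ℕ) : SimpleGraph (Fin t ⊕ Fin (n - t)) :=
  join (⊤ : SimpleGraph (Fin t)) (⊥ : SimpleGraph (Fin (n - t)))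

/-- `F_{n,t} = K_t ∇ (p K₂ ∪ K_q)` with `n - t = 2 p + q` and `q ∈ {0, 1}`,
a graph on `n` vertices (for `t ≤ n`). -/
def F (n t : ℕ) :
    SimpleGraph (Fin t ⊕ ((Fin ((n - t) / 2) × Fin 2) ⊕ Fin ((n - t) % 2))) :=
  join (⊤ : SimpleGraph (Fin t))
    (disjointEdges ((n - t) / 2) ⊕g (⊤ : SimpleGraph (Fin ((n - t) % 2))))

/-- `K_r - M`: the complete graph on `r` vertices with the edges in `M` deleted. -/
def completeMinus (r : ℕ) (M : Set (Sym2 (Fin r))) : SimpleGraph (Fin r) :=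
  (⊤ : SimpleGraph (Fin r)).deleteEdges M

/-- `G[M]`: the subgraph of `G` whose edges are those in `M` and whose vertices are the
endpoints of the edges in `M`. -/
def edgeInduced {V : Type*} (G : SimpleGraph V) (M : Set (Sym2 V)) (hM : M ⊆ G.edgeSet) :
    G.Subgraph where
  verts := {v | ∃ e ∈ M, v ∈ e}
  Adj v w := s(v, w) ∈ M
  adj_sub h := hM h
  edge_vert {v w} h := ⟨s(v, w), h, Sym2.mem_mk_left v w⟩
  symm := ⟨fun v w h => by rwa [Sym2.eq_swap]⟩

end MinorSpectral

/-! Put t = r - 3 and H = K_r - M, and let n be large. It is enough that an H-minor-free G on n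
vertices whose λ(G) is at least that of the extremal graph is isomorphic to it
(`le_and_eq_iff_of_iso`). Both extremal graphs contain K_{t,n-t}, so such a G has λ(G)² ≥ t(n - t).

Excluding H has two coarse effects. G has no K_r minor, so its vertex sets span boundedly many edges
per vertex (`hasCompleteMinorOn_of_degSum`), and any t + 1 vertices have boundedly many common
neighbours (`card_common_nbrs_lt`). Take a nonnegative eigenvector x with maximum 1. In λ²x_v =
∑_{u∼v} ∑_{w∼u} x_w the small entries contribute little by sparsity, the large ones are bounded in
number, and all but boundedly many u see at most t of them. Comparison with t(n - t) yields a set A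
of t vertices with entries near 1 whose common neighbourhood B is almost everything, while all
entries off A are small (`exists_dominating_set`).

Let T join A to everything and contain the edges of G inside B. A vertex v outside A ∪ B misses an
edge to A worth about x_v, which outweighs its few edges to B and its share of the edges outside A ∪
B. So λ(T) ≤ λ(G) forces G = T (`eq_of_lam_le`).

The fine structure of B decides which T to use. Three vertices of B forming a path give H if H lacks
an edge; one edge and a third vertex of B give H if H lacks two edges at a common vertex. So G[B]
has maximum degree at most 1, respectively no edges, and T can be taken to be a copy of F_{n,t},
respectively S_{n,t}. -/

namespace MinorSpectral

open SimpleGraph Finset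

section

open scoped Classical

/-! ### Rayleigh quotients and a nonnegative eigenvector -/

/-- The quadratic form of the adjacency matrix. -/
noncomputable def adjForm {V : Type*} [Fintype V] (G : SimpleGraph V) (x : V → ℝ) : ℝ :=
  ∑ v, x v * ∑ u ∈ G.neighborFinset v, x u

theorem isHermitian_adjMatrix {V : Type*} (G : SimpleGraph V) :
    (G.adjMatrix ℝ).IsHermitian := by
  rw [Matrix.IsHermitian, Matrix.conjTranspose_eq_transpose_of_trivial]
  exact G.isSymm_adjMatrix

theorem adjForm_eq_dotProduct {V : Type*} [Fintype V] (G : SimpleGraph V) (x : V → ℝ) :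
    adjForm G x = x ⬝ᵥ (G.adjMatrix ℝ).mulVec x := by
  simp [adjForm, dotProduct, SimpleGraph.adjMatrix_mulVec_apply]

/-- If μ is an eigenvalue of λI - A, then λ - μ is one of A, so it is at most λ. -/
theorem posSemidef_lam_sub {V : Type*} [Fintype V] [Nonempty V] (G : SimpleGraph V) :
    (lam G • (1 : Matrix V V ℝ) - G.adjMatrix ℝ).PosSemidef := by
  have hH : (lam G • (1 : Matrix V V ℝ) - G.adjMatrix ℝ).IsHermitian := by
    refine Matrix.IsHermitian.sub ?_ (isHermitian_adjMatrix G)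
    rw [Matrix.IsHermitian, Matrix.conjTranspose_eq_transpose_of_trivial]
    simp
  refine hH.posSemidef_iff_eigenvalues_nonneg.2 fun i => ?_
  set μ := hH.eigenvalues i with hμ
  have h1 := hH.mulVec_eigenvectorBasis i
  rw [← hμ] at h1
  set w : V → ℝ := (hH.eigenvectorBasis i).ofLp with hw
  have hw0 : w ≠ 0 := by
    have := hH.eigenvectorBasis.orthonormal.ne_zero i
    intro h
    exact this (by ext j; exact congrFun h j)
  have h2 : (G.adjMatrix ℝ).mulVec w = (lam G - μ) • w := by
    rw [Matrix.sub_mulVec, Matrix.smul_mulVec, Matrix.one_mulVec] at h1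
    rw [sub_smul, ← h1]
    simp
  have h3 : lam G - μ ∈ adjEigenvalues G := by
    unfold adjEigenvalues
    refine Module.End.hasEigenvalue_of_hasEigenvector (x := w)
      ⟨Module.End.mem_eigenspace_iff.2 ?_, hw0⟩
    rw [Matrix.toLin'_apply]
    exact h2
  have h4 := (isGreatest_lam G).2 h3
  simp only [Pi.zero_apply]
  linarith

theorem dotProduct_lam_sub {V : Type*} [Fintype V] (G : SimpleGraph V) (x : V → ℝ) :
    x ⬝ᵥ (lam G • (1 : Matrix V V ℝ) - G.adjMatrix ℝ).mulVec x =
      lam G * ∑ v, x v ^ 2 - adjForm G x := by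
  rw [adjForm_eq_dotProduct, Matrix.sub_mulVec, Matrix.smul_mulVec, Matrix.one_mulVec,
    dotProduct_sub, dotProduct_smul]
  simp [dotProduct, pow_two]

theorem adjForm_le {V : Type*} [Fintype V] [Nonempty V] (G : SimpleGraph V) (x : V → ℝ) :
    adjForm G x ≤ lam G * ∑ v, x v ^ 2 := by
  have h := (posSemidef_lam_sub G).dotProduct_mulVec_nonneg x
  rw [star_trivial, dotProduct_lam_sub] at h
  linarith

/-- A vector at which a positive semidefinite form vanishes lies in the kernel of its matrix. So
every maximizer of the Rayleigh quotient is an eigenvector. -/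
theorem eigen_of_adjForm_eq {V : Type*} [Fintype V] [Nonempty V] (G : SimpleGraph V) (x : V → ℝ)
    (hx : lam G * ∑ v, x v ^ 2 ≤ adjForm G x) (v : V) :
    lam G * x v = ∑ u ∈ G.neighborFinset v, x u := by
  have h := ((posSemidef_lam_sub G).dotProduct_mulVec_zero_iff x).1 (by
    rw [star_trivial, dotProduct_lam_sub]
    linarith [adjForm_le G x])
  have h1 := congrFun h v
  rw [Matrix.sub_mulVec, Matrix.smul_mulVec, Matrix.one_mulVec] at h1
  simp [SimpleGraph.adjMatrix_mulVec_apply] at h1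
  linarith

theorem adjForm_of_eigen {V : Type*} [Fintype V] (G : SimpleGraph V) (x : V → ℝ) (l : ℝ)
    (hx : ∀ v, l * x v = ∑ u ∈ G.neighborFinset v, x u) :
    adjForm G x = l * ∑ v, x v ^ 2 := by
  rw [adjForm, mul_sum]
  refine sum_congr rfl fun v _ => ?_
  rw [← hx]
  ring

/-- The spectral radius has a nonnegative eigenvector with largest entry `1`. -/
theorem exists_nonneg_eigenvector {V : Type*} [Fintype V] [Nonempty V] (G : SimpleGraph V) :
    ∃ x : V → ℝ, (∀ v, 0 ≤ x v) ∧ (∀ v, x v ≤ 1) ∧ (∃ z, x z = 1) ∧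
      ∀ v, lam G * x v = ∑ u ∈ G.neighborFinset v, x u := by
  have h0 := (isGreatest_lam G).1
  unfold adjEigenvalues at h0
  obtain ⟨w, hw⟩ := Module.End.HasEigenvalue.exists_hasEigenvector h0
  have hw1 : ∀ v, lam G * w v = ∑ u ∈ G.neighborFinset v, w u := by
    intro v
    have := congrFun (Module.End.mem_eigenspace_iff.1 hw.1) v
    rw [Matrix.toLin'_apply, SimpleGraph.adjMatrix_mulVec_apply] at this
    simp only [Pi.smul_apply, smul_eq_mul] at this
    exact this.symm
  -- Absolute values keep the norm and do not decrease the form, so |w| is again a maximizer.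
  have hy : ∀ v, lam G * |w v| = ∑ u ∈ G.neighborFinset v, |w u| := by
    refine eigen_of_adjForm_eq G (fun v => |w v|) ?_
    simp only [sq_abs]
    rw [← adjForm_of_eigen G w _ hw1, adjForm, adjForm]
    refine sum_le_sum fun v _ => ?_
    rw [mul_sum, mul_sum]
    refine sum_le_sum fun u _ => ?_
    rw [← abs_mul]
    exact le_abs_self _
  obtain ⟨z, -, hz⟩ := exists_max_image (univ : Finset V) (fun v => |w v|) univ_nonempty
  have hz0 : 0 < |w z| := by
    rw [abs_pos]
    intro h
    refine hw.2 (funext fun v => ?_)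
    have := hz v (mem_univ v)
    rw [h, abs_zero] at this
    exact abs_nonpos_iff.1 this
  refine ⟨fun v => |w v| / |w z|, fun v => by positivity, fun v => ?_, ⟨z, div_self hz0.ne'⟩,
    fun v => ?_⟩
  · exact (div_le_one hz0).2 (hz v (mem_univ v))
  · rw [← sum_div, ← hy v, mul_div_assoc]

theorem adjForm_comp_iso {V W : Type*} [Fintype V] [Fintype W] {G : SimpleGraph V}
    {H : SimpleGraph W} (φ : G ≃g H) (x : W → ℝ) : adjForm G (x ∘ φ) = adjForm H x := by
  unfold adjForm
  refine Fintype.sum_equiv φ.toEquiv _ _ fun v => ?_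
  congr 1
  refine sum_equiv φ.toEquiv (fun u => ?_) fun u _ => rfl
  simp only [mem_neighborFinset]
  exact (φ.map_adj_iff (v := v) (w := u)).symm

theorem lam_le_of_iso {V W : Type*} [Fintype V] [Fintype W] [Nonempty V] {G : SimpleGraph V}
    {H : SimpleGraph W} (φ : G ≃g H) : lam H ≤ lam G := by
  have : Nonempty W := ‹Nonempty V›.map φ
  obtain ⟨x, hx0, -, ⟨z, hz⟩, hx⟩ := exists_nonneg_eigenvector H
  have h1 := adjForm_le G (x ∘ φ)
  rw [adjForm_comp_iso, adjForm_of_eigen H x _ hx] at h1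
  have h2 : ∑ v, (x ∘ φ) v ^ 2 = ∑ w, x w ^ 2 :=
    Fintype.sum_equiv φ.toEquiv _ _ fun v => rfl
  rw [h2] at h1
  refine le_of_mul_le_mul_right h1 ?_
  refine sum_pos' (fun w _ => sq_nonneg _) ⟨z, mem_univ z, ?_⟩
  rw [hz]; norm_num

theorem lam_eq_of_iso {V W : Type*} [Fintype V] [Fintype W] [Nonempty V] {G : SimpleGraph V}
    {H : SimpleGraph W} (φ : G ≃g H) : lam G = lam H := by
  have : Nonempty W := ‹Nonempty V›.map φ
  exact le_antisymm (lam_le_of_iso φ.symm) (lam_le_of_iso φ)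

/-- A graph in which `A` is joined completely to its complement contains a complete bipartite
graph, which bounds its spectral radius from below. -/
theorem sqrt_le_lam {V : Type*} [Fintype V] [Nonempty V] (T : SimpleGraph V) (A : Finset V)
    (hA : 0 < #A) (hAV : #A < Fintype.card V) (hT : ∀ a ∈ A, ∀ v, v ∉ A → T.Adj a v) :
    √(#A * (Fintype.card V - #A : ℕ)) ≤ lam T := by
  have hAc : 0 < #Aᶜ := by rw [card_compl]; omega
  rw [← card_compl]
  set p : ℝ := (#A : ℝ) with hp
  set q : ℝ := (#Aᶜ : ℝ) with hq
  have hp0 : 0 < p := by rw [hp]; exact_mod_cast hA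
  have hq0 : 0 < q := by rw [hq]; exact_mod_cast hAc
  -- The top eigenvector of the complete bipartite graph between `A` and its complement, with
  -- eigenvalue √(pq).
  set x : V → ℝ := fun v => if v ∈ A then √q else √p with hx
  have hx0 : ∀ v, 0 ≤ x v := fun v => by simp only [hx]; split_ifs <;> positivity
  have hsq : ∑ v, x v ^ 2 = 2 * (p * q) := by
    rw [← sum_add_sum_compl A]
    have h1 : ∑ v ∈ A, x v ^ 2 = p * q := by
      rw [sum_congr rfl (g := fun _ => q), sum_const, nsmul_eq_mul]
      intro v hv
      simp [hx, hv, Real.sq_sqrt hq0.le]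
    have h2 : ∑ v ∈ Aᶜ, x v ^ 2 = q * p := by
      rw [sum_congr rfl (g := fun _ => p), sum_const, nsmul_eq_mul]
      intro v hv
      simp [hx, mem_compl.1 hv, Real.sq_sqrt hp0.le]
    rw [h1, h2]; ring
  have hform : 2 * (p * q) * √(p * q) ≤ adjForm T x := by
    rw [adjForm, ← sum_add_sum_compl A]
    have h1 : p * (√q * (q * √p)) ≤ ∑ v ∈ A, x v * ∑ u ∈ T.neighborFinset v, x u := by
      rw [hp, ← nsmul_eq_mul, ← sum_const]
      refine sum_le_sum fun v hv => ?_
      have e : x v = √q := by simp [hx, hv]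
      rw [e]
      refine mul_le_mul_of_nonneg_left ?_ (Real.sqrt_nonneg _)
      rw [hq, ← nsmul_eq_mul, ← sum_const]
      refine le_trans (sum_le_sum fun u hu => ?_) (sum_le_sum_of_subset_of_nonneg
        (s := Aᶜ) (f := x) ?_ fun u _ _ => hx0 u)
      · simp [hx, mem_compl.1 hu, hp]
      · intro u hu
        rw [mem_neighborFinset]
        exact hT v hv u (mem_compl.1 hu)
    have h2 : q * (√p * (p * √q)) ≤ ∑ v ∈ Aᶜ, x v * ∑ u ∈ T.neighborFinset v, x u := by
      rw [hq, ← nsmul_eq_mul, ← sum_const]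
      refine sum_le_sum fun v hv => ?_
      have e : x v = √p := by simp [hx, mem_compl.1 hv]
      rw [e]
      refine mul_le_mul_of_nonneg_left ?_ (Real.sqrt_nonneg _)
      rw [hp, ← nsmul_eq_mul, ← sum_const]
      refine le_trans (sum_le_sum fun u hu => ?_) (sum_le_sum_of_subset_of_nonneg
        (s := A) (f := x) ?_ fun u _ _ => hx0 u)
      · simp [hx, hu, hq]
      · intro u hu
        rw [mem_neighborFinset]
        exact (hT u hu v (mem_compl.1 hv)).symm
    rw [Real.sqrt_mul hp0.le]
    linarith
  have h := hform.trans (adjForm_le T x)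
  rw [hsq, mul_comm (lam T)] at h
  exact le_of_mul_le_mul_left h (by positivity)

/-! ### Density forces complete minors (Mader's argument) -/

/-- Twice the number of edges of `G` inside the finite set `X`. -/
noncomputable def degSum {V : Type*} (G : SimpleGraph V) (X : Finset V) : ℕ :=
  ∑ v ∈ X, #{u ∈ X | G.Adj v u}

theorem degSum_insert {V : Type*} (G : SimpleGraph V) {X : Finset V} {w : V} (hw : w ∉ X) :
    degSum G (insert w X) = degSum G X + 2 * #{u ∈ X | G.Adj w u} := by
  unfold degSum
  rw [sum_insert hw]
  have h1 : #{u ∈ insert w X | G.Adj w u} = #{u ∈ X | G.Adj w u} := by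
    rw [filter_insert, if_neg (G.loopless.irrefl w)]
  have h2 : ∀ v ∈ X, #{u ∈ insert w X | G.Adj v u} =
      #{u ∈ X | G.Adj v u} + if G.Adj w v then 1 else 0 := by
    intro v _
    rw [filter_insert]
    by_cases h : G.Adj v w
    · rw [if_pos h, if_pos h.symm, card_insert_of_notMem (by simp [hw])]
    · rw [if_neg h, if_neg fun h' => h h'.symm, add_zero]
  rw [h1, sum_congr rfl h2, sum_add_distrib, ← card_filter]
  ring

theorem induce_insert_connected {V : Type*} {G : SimpleGraph V} {s : Set V} {u w : V}
    (hs : (G.induce s).Connected) (hu : u ∈ s) (huw : G.Adj u w) :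
    (G.induce (insert w s)).Connected := by
  have h := induce_union_connected hs.preconnected
    (induce_pair_connected_of_adj huw).preconnected ⟨u, hu, Set.mem_insert _ _⟩
  have e : s ∪ {u, w} = insert w s := by
    ext y
    simp only [Set.mem_union, Set.mem_insert_iff, Set.mem_singleton_iff]
    constructor
    · rintro (h | rfl | rfl)
      · exact Or.inr h
      · exact Or.inr hu
      · exact Or.inl rfl
    · rintro (rfl | h)
      · exact Or.inr (Or.inr rfl)
      · exact Or.inl h
  rwa [e] at h

theorem induce_singleton_connected {V : Type*} (G : SimpleGraph V) (v : V) :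
    (G.induce ({v} : Set V)).Connected := by
  have : Nonempty ({v} : Set V) := ⟨⟨v, rfl⟩⟩
  exact ⟨Preconnected.of_subsingleton⟩

/-- `G` has a complete minor on `m` vertices with all branch sets inside `X`. -/
def HasCompleteMinorOn {V : Type*} (G : SimpleGraph V) (X : Finset V) (m : ℕ) : Prop :=
  ∃ B : Fin m → Set V, (∀ i, (G.induce (B i)).Connected) ∧
    (∀ i j, i ≠ j → Disjoint (B i) (B j)) ∧
    (∀ i j, i ≠ j → ∃ x ∈ B i, ∃ y ∈ B j, G.Adj x y) ∧ ∀ i, B i ⊆ X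

theorem HasCompleteMinorOn.mono {V : Type*} {G : SimpleGraph V} {X Y : Finset V} {m : ℕ}
    (h : HasCompleteMinorOn G X m) (hXY : X ⊆ Y) : HasCompleteMinorOn G Y m := by
  obtain ⟨B, h1, h2, h3, h4⟩ := h
  exact ⟨B, h1, h2, h3, fun i => (h4 i).trans (by exact_mod_cast hXY)⟩

/-- Every branch set inside `N` is nonempty and so has a neighbour in `U`; thus `U` serves as one
more branch set. -/
theorem HasCompleteMinorOn.cons {V : Type*} {G : SimpleGraph V} {X U N : Finset V} {m : ℕ}
    (h : HasCompleteMinorOn G N m) (hN : N ⊆ X) (hU : U ⊆ X) (hd : Disjoint U N)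
    (hc : (G.induce (U : Set V)).Connected) (hadj : ∀ w ∈ N, ∃ u ∈ U, G.Adj u w) :
    HasCompleteMinorOn G X (m + 1) := by
  obtain ⟨B, h1, h2, h3, h4⟩ := h
  have hdB : ∀ i, Disjoint (U : Set V) (B i) := fun i =>
    (disjoint_coe.2 hd).mono_right (h4 i)
  have hne : ∀ i, ∃ x ∈ (U : Set V), ∃ y ∈ B i, G.Adj x y := by
    intro i
    obtain ⟨⟨y, hy⟩⟩ := (h1 i).nonempty
    obtain ⟨u, hu, huy⟩ := hadj y (by exact_mod_cast h4 i hy)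
    exact ⟨u, by exact_mod_cast hu, y, hy, huy⟩
  refine ⟨Fin.cons (U : Set V) B, ?_, ?_, ?_, ?_⟩
  · intro i
    refine Fin.cases ?_ (fun i => ?_) i
    · exact hc
    · exact h1 i
  · intro i j
    refine Fin.cases ?_ (fun i => ?_) i <;> refine Fin.cases ?_ (fun j => ?_) j
    · intro h; exact absurd rfl h
    · intro _; exact hdB j
    · intro _; exact (hdB i).symm
    · intro h; exact h2 i j fun e => h (e ▸ rfl)
  · intro i j
    refine Fin.cases ?_ (fun i => ?_) i <;> refine Fin.cases ?_ (fun j => ?_) j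
    · intro h; exact absurd rfl h
    · intro _; exact hne j
    · intro _
      obtain ⟨x, hx, y, hy, hxy⟩ := hne i
      exact ⟨y, hy, x, hx, hxy.symm⟩
    · intro h; exact h3 i j fun e => h (e ▸ rfl)
  · intro i
    refine Fin.cases ?_ (fun i => ?_) i
    · exact_mod_cast hU
    · exact (h4 i).trans (by exact_mod_cast hN)

/-- The vertices of `X` outside `U` with a neighbour in `U`. -/
noncomputable def outerNbrs {V : Type*} (G : SimpleGraph V) (X U : Finset V) : Finset V :=
  {w ∈ X \ U | ∃ u ∈ U, G.Adj u w}

/-- The effect on the degree of the contracted vertex when `w` is absorbed into `U`: `w` leaves the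
boundary, its outside neighbours enter, and those already in the boundary are not counted again. -/
theorem card_outerNbrs_insert {V : Type*} (G : SimpleGraph V) {X U : Finset V} {w : V}
    (hw : w ∈ outerNbrs G X U) :
    #(outerNbrs G X (insert w U)) + 1 + #{u ∈ outerNbrs G X U | G.Adj w u} =
      #(outerNbrs G X U) + #{u ∈ (X \ U).erase w | G.Adj w u} := by
  have h1 : outerNbrs G X (insert w U) =
      (outerNbrs G X U).erase w ∪ {u ∈ (X \ U).erase w | G.Adj w u} := by
    ext y
    simp only [outerNbrs, mem_filter, mem_sdiff, mem_insert, mem_union, mem_erase]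
    constructor
    · rintro ⟨⟨hy, hyU⟩, u, rfl | hu, huy⟩
      · exact Or.inr ⟨⟨fun e => hyU (Or.inl e), hy, fun e => hyU (Or.inr e)⟩, huy⟩
      · exact Or.inl ⟨fun e => hyU (Or.inl e), ⟨hy, fun e => hyU (Or.inr e)⟩, u, hu, huy⟩
    · rintro (⟨hyw, ⟨hy, hyU⟩, u, hu, huy⟩ | ⟨⟨hyw, hy, hyU⟩, hwy⟩)
      · exact ⟨⟨hy, by tauto⟩, u, Or.inr hu, huy⟩
      · exact ⟨⟨hy, by tauto⟩, w, Or.inl rfl, hwy⟩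
  have h2 : (outerNbrs G X U).erase w ∩ {u ∈ (X \ U).erase w | G.Adj w u} =
      {u ∈ outerNbrs G X U | G.Adj w u} := by
    ext y
    simp only [outerNbrs, mem_filter, mem_sdiff, mem_inter, mem_erase]
    constructor
    · rintro ⟨⟨_, h⟩, _, h'⟩
      exact ⟨h, h'⟩
    · rintro ⟨h, h'⟩
      exact ⟨⟨h'.ne', h⟩, ⟨h'.ne', h.1⟩, h'⟩
  have h3 := card_union_add_card_inter ((outerNbrs G X U).erase w)
    {u ∈ (X \ U).erase w | G.Adj w u}
  rw [← h1, h2] at h3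
  have h4 := card_erase_add_one hw
  omega

/-- Large average degree forces a complete minor. -/
theorem hasCompleteMinorOn_of_degSum {V : Type*} (G : SimpleGraph V) (k : ℕ) :
    ∀ X : Finset V, X.Nonempty → 2 ^ k * #X ≤ degSum G X → HasCompleteMinorOn G X (k + 1) := by
  induction k with
  | zero =>
    rintro X ⟨v, hv⟩ -
    refine ⟨fun _ => {v}, fun _ => induce_singleton_connected G v, ?_, ?_, ?_⟩
    · intro i j h; exact absurd (by omega) h
    · intro i j h; exact absurd (by omega) h
    · intro _; simpa using hv
  | succ k ih =>
    intro X
    induction hn : #X using Nat.strong_induction_on generalizing X with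
    | _ n ihX =>
    subst hn
    intro hX hdeg
    -- Contracting `U` to one vertex leaves `#(X \ U) + 1` vertices, and the right side is the
    -- degree sum of the contracted graph. A largest `U` is taken for which the density survives.
    set good : Finset V → Prop := fun U => (G.induce (U : Set V)).Connected ∧
      2 ^ (k + 1) * (#(X \ U) + 1) ≤ degSum G (X \ U) + 2 * #(outerNbrs G X U) with hgood
    have hex : (X.powerset.filter good).Nonempty := by
      obtain ⟨v, hv⟩ := hX
      refine ⟨{v}, mem_filter.2 ⟨by simpa using hv, ?_, ?_⟩⟩
      · rw [coe_singleton]; exact induce_singleton_connected G v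
      · have hi : insert v (X.erase v) = X := insert_erase hv
        have h1 := degSum_insert G (notMem_erase v X)
        rw [hi] at h1
        have h2 : X \ {v} = X.erase v := sdiff_singleton_eq_erase v X
        have h3 : outerNbrs G X {v} = {u ∈ X.erase v | G.Adj v u} := by
          simp [outerNbrs, h2]
        rw [h3, h2, ← h1, card_erase_add_one hv]
        exact hdeg
    obtain ⟨U, hU, hmax⟩ := exists_max_image _ (fun U => #U) hex
    obtain ⟨hUX, hUc, hUd⟩ := mem_filter.1 hU
    rw [mem_powerset] at hUX
    -- With an empty boundary the contracted vertex is isolated, so the smaller set `X \ U` is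
    -- already dense enough.
    rcases (outerNbrs G X U).eq_empty_or_nonempty with hN | hN
    · rw [hN, card_empty, mul_zero, add_zero] at hUd
      have hpos : 0 < 2 ^ (k + 1) := by positivity
      have hne : (X \ U).Nonempty := by
        rw [nonempty_iff_ne_empty]
        intro h
        rw [h] at hUd
        simp [degSum] at hUd
      have hlt : #(X \ U) < #X := by
        refine card_lt_card ⟨sdiff_subset, fun h => ?_⟩
        obtain ⟨⟨u, hu⟩⟩ := hUc.nonempty
        exact (mem_sdiff.1 (h (hUX (by exact_mod_cast hu)))).2 (by exact_mod_cast hu)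
      exact (ihX _ hlt _ rfl hne (by nlinarith)).mono sdiff_subset
    · have hNX : outerNbrs G X U ⊆ X := fun w hw =>
        (mem_sdiff.1 (mem_filter.1 hw).1).1
      refine (ih (outerNbrs G X U) hN ?_).cons hNX hUX ?_ hUc fun w hw => (mem_filter.1 hw).2
      · rw [mul_comm, ← smul_eq_mul, ← sum_const, degSum]
        refine sum_le_sum fun w hw => ?_
        obtain ⟨hwX, u, hu, huw⟩ := mem_filter.1 hw
        obtain ⟨hwX, hwU⟩ := mem_sdiff.1 hwX
        -- If `w` had fewer than 2^k neighbours in the boundary, absorbing it would lose at most 2^k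
        -- edges and one vertex, keeping the density and contradicting the maximality of `U`. So the
        -- boundary has density 2^k, and `U` is adjacent to all of it.
        by_contra! hlt
        have h1 := card_outerNbrs_insert G hw
        have hins : insert w ((X \ U).erase w) = X \ U := insert_erase (mem_sdiff.2 ⟨hwX, hwU⟩)
        have h2 := degSum_insert G (notMem_erase w (X \ U))
        rw [hins] at h2
        have h3 : X \ insert w U = (X \ U).erase w := by
          ext y; simp only [mem_sdiff, mem_insert, mem_erase]; tauto
        have h4 := card_erase_add_one (mem_sdiff.2 ⟨hwX, hwU⟩ : w ∈ X \ U)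
        have h5 : insert w U ∈ X.powerset.filter good := by
          refine mem_filter.2 ⟨mem_powerset.2 (insert_subset hwX hUX), ?_, ?_⟩
          · rw [coe_insert]
            exact induce_insert_connected hUc (by exact_mod_cast hu) huw
          · rw [h3, h4]
            rw [pow_succ] at hUd ⊢
            nlinarith
        have h6 := hmax _ h5
        rw [card_insert_of_notMem hwU] at h6
        omega
      · rw [disjoint_right]
        exact fun w hw => (mem_sdiff.1 (mem_filter.1 hw).1).2

theorem degSum_le_of_minorFree {V : Type*} {r : ℕ} (hr : 1 ≤ r) {H : SimpleGraph (Fin r)}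
    {G : SimpleGraph V} (h : MinorFree H G) (X : Finset V) : degSum G X ≤ 2 ^ (r - 1) * #X := by
  rcases X.eq_empty_or_nonempty with rfl | hX
  · simp [degSum]
  by_contra! hlt
  have h1 := hasCompleteMinorOn_of_degSum G (r - 1) X hX hlt.le
  rw [Nat.sub_add_cancel hr] at h1
  obtain ⟨B, h1, h2, h3, -⟩ := h1
  exact h ⟨B, h1, h2, fun i j hij => h3 i j hij.ne⟩

/-! ### Minors built on a set with many common neighbours -/

theorem exists_injOn_mapsTo {α β : Type*} {s : Finset α} {t : Finset β} (h : #s ≤ #t)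
    [Nonempty β] : ∃ f : α → β, (∀ a ∈ s, f a ∈ t) ∧ Set.InjOn f s := by
  obtain ⟨f, h1, h2⟩ := s.finite_toSet.exists_injOn_of_encard_le (t := (t : Set β))
    (by simpa [Set.encard_coe_eq_coe_finsetCard] using h)
  exact ⟨f, fun a ha => by exact_mod_cast h1 (by exact_mod_cast ha), h2⟩

theorem induce_coe_singleton_connected {V : Type*} (G : SimpleGraph V) (v : V) :
    (G.induce (({v} : Finset V) : Set V)).Connected := by
  rw [coe_singleton]
  exact induce_singleton_connected G v

theorem induce_coe_pair_connected {V : Type*} {G : SimpleGraph V} {u v : V} (h : G.Adj u v) :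
    (G.induce (({u, v} : Finset V) : Set V)).Connected := by
  rw [coe_pair]
  exact induce_pair_connected_of_adj h

/-- A minor whose vertices outside `S` are represented by the vertices of `A`, each made adjacent
to everything by a common neighbour of `A`. -/
theorem isMinor_of_common_nbrs {V : Type*} {r : ℕ} {H : SimpleGraph (Fin r)} {G : SimpleGraph V}
    (S : Finset (Fin r)) (P : Fin r → Finset V) (A B : Finset V)
    (hA : r ≤ #A + #S) (hAB : ∀ a ∈ A, ∀ b ∈ B, G.Adj a b)
    (hB : r + #(S.biUnion P) ≤ #B) (hrpos : 0 < r)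
    (hconn : ∀ w ∈ S, (G.induce (P w : Set V)).Connected)
    (hdisj : ∀ w ∈ S, ∀ w' ∈ S, w ≠ w' → Disjoint (P w) (P w'))
    (hPA : ∀ w ∈ S, Disjoint (P w) A) (hPB : ∀ w ∈ S, ∃ b ∈ B, b ∈ P w)
    (hadj : ∀ w ∈ S, ∀ w' ∈ S, H.Adj w w' → ∃ x ∈ P w, ∃ y ∈ P w', G.Adj x y) :
    IsMinor H G := by
  have hne : Nonempty V := by
    obtain ⟨b, -⟩ := card_pos.1 (by omega : 0 < #B)
    exact ⟨b⟩
  have hSc : #Sᶜ = r - #S := by rw [card_compl, Fintype.card_fin]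
  -- Each vertex `w` outside `S` gets the edge from `α w` in `A` to `β w` in `B` as branch set.
  -- Since `α w` sees all of `B`, this set is adjacent to every set meeting `B`.
  obtain ⟨α, hα, hαi⟩ := exists_injOn_mapsTo (s := Sᶜ) (t := A) (by omega)
  obtain ⟨β, hβ, hβi⟩ := exists_injOn_mapsTo (s := Sᶜ) (t := B \ S.biUnion P) (by
    have := le_card_sdiff (S.biUnion P) B
    omega)
  have hβB : ∀ w, w ∉ S → β w ∈ B := fun w hw => (mem_sdiff.1 (hβ w (mem_compl.2 hw))).1
  have hβP : ∀ w, w ∉ S → ∀ w' ∈ S, β w ∉ P w' := fun w hw w' hw' h =>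
    (mem_sdiff.1 (hβ w (mem_compl.2 hw))).2 (mem_biUnion.2 ⟨w', hw', h⟩)
  have hαA : ∀ w, w ∉ S → α w ∈ A := fun w hw => hα w (mem_compl.2 hw)
  have hαβ : ∀ w w', w ∉ S → w' ∉ S → G.Adj (α w) (β w') := fun w w' hw hw' =>
    hAB _ (hαA w hw) _ (hβB w' hw')
  have hmix : ∀ w ∈ S, ∀ w', w' ∉ S → Disjoint (P w : Set V) {α w', β w'} := by
    intro w hw w' hw'
    rw [Set.disjoint_right]
    rintro y (rfl | rfl) hy
    · exact disjoint_left.1 (hPA w hw) (by exact_mod_cast hy) (hαA w' hw')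
    · exact hβP w' hw' w hw (by exact_mod_cast hy)
  refine ⟨fun w => if w ∈ S then (P w : Set V) else {α w, β w}, fun w => ?_, fun w w' hww => ?_,
    fun w w' hww => ?_⟩
  · by_cases hw : w ∈ S
    · beta_reduce
      rw [if_pos hw]
      exact hconn w hw
    · beta_reduce
      rw [if_neg hw]
      exact induce_pair_connected_of_adj (hαβ w w hw hw)
  · by_cases hw : w ∈ S <;> by_cases hw' : w' ∈ S <;> simp only [hw, hw', if_true, if_false]
    · exact disjoint_coe.2 (hdisj w hw w' hw' hww)
    · exact hmix w hw w' hw'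
    · exact (hmix w' hw' w hw).symm
    · rw [Set.disjoint_left]
      rintro y (rfl | rfl) (h | h)
      · exact hww (hαi (by simpa using hw) (by simpa using hw') h)
      · exact (hαβ w w' hw hw').ne h
      · exact (hαβ w' w hw' hw).ne h.symm
      · exact hww (hβi (by simpa using hw) (by simpa using hw') h)
  · by_cases hw : w ∈ S <;> by_cases hw' : w' ∈ S <;> simp only [hw, hw', if_true, if_false]
    · obtain ⟨x, hx, y, hy, h⟩ := hadj w hw w' hw' hww
      exact ⟨x, hx, y, hy, h⟩
    · obtain ⟨b, hb, hbP⟩ := hPB w hw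
      exact ⟨b, hbP, α w', Or.inl rfl, (hAB _ (hαA w' hw') b hb).symm⟩
    · obtain ⟨b, hb, hbP⟩ := hPB w' hw'
      exact ⟨α w, Or.inl rfl, b, hbP, hAB _ (hαA w hw) b hb⟩
    · exact ⟨α w, Or.inl rfl, β w', Or.inr rfl, hαβ w w' hw hw'⟩

/-- The version of `isMinor_of_common_nbrs` with three further branch sets, two of which need not
be adjacent. -/
theorem isMinor_of_three {V : Type*} {r : ℕ} {H : SimpleGraph (Fin r)} {G : SimpleGraph V}
    {c p q : Fin r} (hcp : c ≠ p) (hcq : c ≠ q) (hpq : p ≠ q) (hH : ¬ H.Adj p q)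
    {A B : Finset V} (hA : r ≤ #A + 3) (hAB : ∀ a ∈ A, ∀ b ∈ B, G.Adj a b)
    {C P Q : Finset V} (hB : r + (#C + #P + #Q) ≤ #B)
    (hC : (G.induce (C : Set V)).Connected) (hP : (G.induce (P : Set V)).Connected)
    (hQ : (G.induce (Q : Set V)).Connected)
    (hCP : Disjoint C P) (hCQ : Disjoint C Q) (hPQ : Disjoint P Q)
    (hCA : Disjoint C A) (hPA : Disjoint P A) (hQA : Disjoint Q A)
    (hCB : ∃ b ∈ B, b ∈ C) (hPB : ∃ b ∈ B, b ∈ P) (hQB : ∃ b ∈ B, b ∈ Q)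
    (aCP : ∃ x ∈ C, ∃ y ∈ P, G.Adj x y) (aCQ : H.Adj c q → ∃ x ∈ C, ∃ y ∈ Q, G.Adj x y) :
    IsMinor H G := by
  set F : Fin r → Finset V := fun w => if w = c then C else if w = p then P else Q with hF
  have ec : F c = C := by simp [hF]
  have ep : F p = P := by simp [hF, hcp.symm]
  have eq : F q = Q := by simp [hF, hcq.symm, hpq.symm]
  have hmem : ∀ w ∈ ({c, p, q} : Finset (Fin r)), w = c ∨ w = p ∨ w = q := by simp
  refine isMinor_of_common_nbrs {c, p, q} F A B ?_ hAB ?_ (Fin.pos c) ?_ ?_ ?_ ?_ ?_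
  · rw [card_eq_three.2 ⟨c, p, q, hcp, hcq, hpq, rfl⟩]
    exact hA
  · have h : ({c, p, q} : Finset (Fin r)).biUnion F = C ∪ (P ∪ Q) := by
      simp [biUnion_insert, ec, ep, eq]
    have h1 := card_union_le C (P ∪ Q)
    have h2 := card_union_le P Q
    rw [h]
    omega
  · intro w hw
    rcases hmem w hw with rfl | rfl | rfl
    · rwa [ec]
    · rwa [ep]
    · rwa [eq]
  · intro w hw w' hw' hne
    rcases hmem w hw with rfl | rfl | rfl <;> rcases hmem w' hw' with rfl | rfl | rfl <;>
      simp only [ec, ep, eq] <;>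
      first | exact absurd rfl hne | assumption | (apply Disjoint.symm; assumption)
  · intro w hw
    rcases hmem w hw with rfl | rfl | rfl
    · rwa [ec]
    · rwa [ep]
    · rwa [eq]
  · intro w hw
    rcases hmem w hw with rfl | rfl | rfl
    · rwa [ec]
    · rwa [ep]
    · rwa [eq]
  · have hsymm : ∀ X Y : Finset V, (∃ x ∈ X, ∃ y ∈ Y, G.Adj x y) →
        ∃ x ∈ Y, ∃ y ∈ X, G.Adj x y := by
      rintro X Y ⟨x, hx, y, hy, h⟩
      exact ⟨y, hy, x, hx, h.symm⟩
    intro w hw w' hw' h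
    rcases hmem w hw with rfl | rfl | rfl <;> rcases hmem w' hw' with rfl | rfl | rfl <;>
      simp only [ec, ep, eq]
    · exact absurd h (H.loopless.irrefl _)
    · exact aCP
    · exact aCQ h
    · exact hsymm _ _ aCP
    · exact absurd h (H.loopless.irrefl _)
    · exact absurd h hH
    · exact hsymm _ _ (aCQ h.symm)
    · exact absurd h.symm hH
    · exact absurd h (H.loopless.irrefl _)

section Consequences

variable {V : Type*} {r : ℕ} {H : SimpleGraph (Fin r)} {G : SimpleGraph V} {c p q : Fin r}
  {A B : Finset V}

theorem disjoint_of_complete (hAB : ∀ a ∈ A, ∀ b ∈ B, G.Adj a b) {b : V} (hb : b ∈ B) : b ∉ A :=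
  fun h => (hAB b h b hb).ne rfl

/-- A graph without the minor has few common neighbours of any `r - 2` vertices. -/
theorem card_common_nbrs_lt (hG : MinorFree H G) (hcp : c ≠ p) (hcq : c ≠ q) (hpq : p ≠ q)
    (hH : ¬ H.Adj p q) (hA : r ≤ #A + 2) (hA0 : A.Nonempty)
    (hAB : ∀ a ∈ A, ∀ b ∈ B, G.Adj a b) : #B < r + 4 := by
  by_contra! hB
  obtain ⟨a, ha⟩ := hA0
  obtain ⟨b₀, b₁, b₂, h0, h1, h2, h01, h02, h12⟩ := two_lt_card_iff.1 (by omega : 2 < #B)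
  have n0 := disjoint_of_complete hAB h0
  have n1 := disjoint_of_complete hAB h1
  have n2 := disjoint_of_complete hAB h2
  have a1 := hAB a ha b₁ h1
  have a2 := hAB a ha b₂ h2
  have hc2 : #({a, b₀} : Finset V) ≤ 2 := card_le_two
  -- The surplus vertex `a`, joined to `b₀`, becomes the centre, adjacent to `b₁` and `b₂`; at least
  -- r - 3 vertices of `A` remain. The bound r + 4 is r + (2 + 1 + 1).
  refine hG (isMinor_of_three hcp hcq hpq hH (A := A.erase a) (B := B) (C := {a, b₀}) (P := {b₁})
    (Q := {b₂}) ?_ (fun a' ha' => hAB a' (mem_of_mem_erase ha')) ?_ ?_ ?_ ?_ ?_ ?_ ?_ ?_ ?_ ?_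
    ⟨b₀, h0, by simp⟩ ⟨b₁, h1, by simp⟩ ⟨b₂, h2, by simp⟩ ⟨a, by simp, b₁, by simp, a1⟩
    fun _ => ⟨a, by simp, b₂, by simp, a2⟩)
  · have := card_erase_add_one ha; omega
  · simp only [card_singleton]; omega
  · exact induce_coe_pair_connected (hAB a ha b₀ h0)
  · exact induce_coe_singleton_connected G b₁
  · exact induce_coe_singleton_connected G b₂
  · simp [a1.ne', h01.symm]
  · simp [a2.ne', h02.symm]
  · simpa using h12
  · simp [n0]
  · simp [n1]
  · simp [n2]

/-- Two neighbours of `u` inside `B` would give a path whose ends represent the nonadjacent pair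
`p`, `q`. -/
theorem common_nbrs_degree_le_one (hG : MinorFree H G) (hcp : c ≠ p) (hcq : c ≠ q) (hpq : p ≠ q)
    (hH : ¬ H.Adj p q) (hA : r ≤ #A + 3) (hAB : ∀ a ∈ A, ∀ b ∈ B, G.Adj a b)
    (hB : r + 4 ≤ #B) {u v w : V} (hu : u ∈ B) (hv : v ∈ B) (hw : w ∈ B)
    (huv : G.Adj u v) (huw : G.Adj u w) : v = w := by
  by_contra hvw
  have nu := disjoint_of_complete hAB hu
  have nv := disjoint_of_complete hAB hv
  have nw := disjoint_of_complete hAB hw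
  refine hG (isMinor_of_three hcp hcq hpq hH (A := A) (B := B) (C := {u}) (P := {v})
    (Q := {w}) hA hAB ?_ ?_ ?_ ?_ ?_ ?_ ?_ ?_ ?_ ?_
    ⟨u, hu, by simp⟩ ⟨v, hv, by simp⟩ ⟨w, hw, by simp⟩ ⟨u, by simp, v, by simp, huv⟩
    fun _ => ⟨u, by simp, w, by simp, huw⟩)
  · simp only [card_singleton]; omega
  · exact induce_coe_singleton_connected G u
  · exact induce_coe_singleton_connected G v
  · exact induce_coe_singleton_connected G w
  · simp [huv.ne]
  · simp [huw.ne]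
  · simpa using hvw
  · simp [nu]
  · simp [nv]
  · simp [nw]

/-- With three neighbours in `B`, `v` could absorb one of them, so as to meet `B`, and be the centre
adjacent to the other two. -/
theorem card_nbrs_in_common_nbrs_le_two (hG : MinorFree H G) (hcp : c ≠ p) (hcq : c ≠ q)
    (hpq : p ≠ q) (hH : ¬ H.Adj p q) (hA : r ≤ #A + 3) (hAB : ∀ a ∈ A, ∀ b ∈ B, G.Adj a b)
    (hB : r + 4 ≤ #B) {v : V} (hvA : v ∉ A) : #{b ∈ B | G.Adj v b} ≤ 2 := by
  by_contra! hlt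
  obtain ⟨b₀, b₁, b₂, h0, h1, h2, h01, h02, h12⟩ := two_lt_card_iff.1 hlt
  obtain ⟨h0, a0⟩ := mem_filter.1 h0
  obtain ⟨h1, a1⟩ := mem_filter.1 h1
  obtain ⟨h2, a2⟩ := mem_filter.1 h2
  have n0 := disjoint_of_complete hAB h0
  have n1 := disjoint_of_complete hAB h1
  have n2 := disjoint_of_complete hAB h2
  have hc2 : #({v, b₀} : Finset V) ≤ 2 := card_le_two
  refine hG (isMinor_of_three hcp hcq hpq hH (A := A) (B := B) (C := {v, b₀}) (P := {b₁})
    (Q := {b₂}) hA hAB ?_ ?_ ?_ ?_ ?_ ?_ ?_ ?_ ?_ ?_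
    ⟨b₀, h0, by simp⟩ ⟨b₁, h1, by simp⟩ ⟨b₂, h2, by simp⟩ ⟨v, by simp, b₁, by simp, a1⟩
    fun _ => ⟨v, by simp, b₂, by simp, a2⟩)
  · simp only [card_singleton]; omega
  · exact induce_coe_pair_connected a0
  · exact induce_coe_singleton_connected G b₁
  · exact induce_coe_singleton_connected G b₂
  · simp [a1.ne', h01.symm]
  · simp [a2.ne', h02.symm]
  · simpa using h12
  · simp [n0, hvA]
  · simp [n1]
  · simp [n2]

/-- When `q` is adjacent to neither `c` nor `p`, an edge of `B` represents `c` and `p`, and any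
third vertex of `B` represents `q`. -/
theorem common_nbrs_independent (hG : MinorFree H G) (hcp : c ≠ p) (hcq : c ≠ q) (hpq : p ≠ q)
    (hH : ¬ H.Adj p q) (hH' : ¬ H.Adj c q) (hA : r ≤ #A + 3)
    (hAB : ∀ a ∈ A, ∀ b ∈ B, G.Adj a b) (hB : r + 4 ≤ #B) {u v : V} (hu : u ∈ B) (hv : v ∈ B) :
    ¬ G.Adj u v := by
  intro huv
  have hcard : #({u, v} : Finset V) ≤ 2 := card_le_two
  obtain ⟨w, hw, hw'⟩ := exists_mem_notMem_of_card_lt_card (s := {u, v}) (t := B) (by omega)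
  simp only [mem_insert, mem_singleton, not_or] at hw'
  have nu := disjoint_of_complete hAB hu
  have nv := disjoint_of_complete hAB hv
  have nw := disjoint_of_complete hAB hw
  refine hG (isMinor_of_three hcp hcq hpq hH (A := A) (B := B) (C := {u}) (P := {v})
    (Q := {w}) hA hAB ?_ ?_ ?_ ?_ ?_ ?_ ?_ ?_ ?_ ?_
    ⟨u, hu, by simp⟩ ⟨v, hv, by simp⟩ ⟨w, hw, by simp⟩ ⟨u, by simp, v, by simp, huv⟩
    fun h => absurd h hH')
  · simp only [card_singleton]; omega
  · exact induce_coe_singleton_connected G u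
  · exact induce_coe_singleton_connected G v
  · exact induce_coe_singleton_connected G w
  · simp [huv.ne]
  · simpa using Ne.symm hw'.1
  · simpa using Ne.symm hw'.2
  · simp [nu]
  · simp [nv]
  · simp [nw]

end Consequences

/-! ### Eigenvector entries in sparse graphs -/

section Eigenvector

variable {V : Type*} [Fintype V] {G : SimpleGraph V} {D : ℕ}

theorem sum_card_nbrs_in_le {V : Type*} {G : SimpleGraph V} {D : ℕ} (hD : ∀ X, degSum G X ≤ D * #X) (X Y : Finset V) :
    (∑ u ∈ X, (#{w ∈ Y | G.Adj u w} : ℝ)) ≤ D * (#X + #Y) := by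
  have h : ∑ u ∈ X, #{w ∈ Y | G.Adj u w} ≤ D * (#X + #Y) := by
    calc ∑ u ∈ X, #{w ∈ Y | G.Adj u w} ≤ ∑ u ∈ X, #{w ∈ X ∪ Y | G.Adj u w} :=
          sum_le_sum fun u _ => card_le_card (filter_subset_filter _ subset_union_right)
      _ ≤ degSum G (X ∪ Y) := sum_le_sum_of_subset subset_union_left
      _ ≤ D * #(X ∪ Y) := hD _
      _ ≤ D * (#X + #Y) := Nat.mul_le_mul_left _ (card_union_le _ _)
  exact_mod_cast h

theorem sum_degree_le (hD : ∀ X, degSum G X ≤ D * #X) (X : Finset V) :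
    (∑ u ∈ X, (#(G.neighborFinset u) : ℝ)) ≤ D * Fintype.card V := by
  have h : ∑ u ∈ X, #(G.neighborFinset u) ≤ D * Fintype.card V := by
    refine le_trans (sum_le_sum_of_subset (subset_univ X)) (le_trans (le_of_eq ?_) (hD univ))
    refine sum_congr rfl fun u _ => ?_
    congr 1
    ext w
    simp
  exact_mod_cast h

variable {x : V → ℝ} {l : ℝ}

/-- Two steps of the eigenvector equation, with the small entries estimated trivially. -/
theorem sq_mul_le (hD : ∀ X, degSum G X ≤ D * #X)
    (hx : ∀ v, l * x v = ∑ u ∈ G.neighborFinset v, x u) {e : ℝ} (he : 0 ≤ e) (v : V) :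
    l ^ 2 * x v ≤ e * D * Fintype.card V +
      ∑ u ∈ G.neighborFinset v, ∑ w ∈ {w ∈ univ.filter (fun w => e < x w) | G.Adj u w}, x w := by
  have h1 : ∀ u, ∑ w ∈ G.neighborFinset u, x w ≤ e * #(G.neighborFinset u) +
      ∑ w ∈ {w ∈ univ.filter (fun w => e < x w) | G.Adj u w}, x w := by
    intro u
    rw [← sum_filter_add_sum_filter_not (G.neighborFinset u) (fun w => e < x w), add_comm]
    refine add_le_add ?_ (le_of_eq ?_)
    · calc ∑ w ∈ (G.neighborFinset u).filter (fun w => ¬ e < x w), x w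
          ≤ ∑ w ∈ (G.neighborFinset u).filter (fun w => ¬ e < x w), e :=
            sum_le_sum fun w hw => not_lt.1 (mem_filter.1 hw).2
        _ = e * #((G.neighborFinset u).filter (fun w => ¬ e < x w)) := by
            rw [sum_const, nsmul_eq_mul, mul_comm]
        _ ≤ e * #(G.neighborFinset u) := by
            refine mul_le_mul_of_nonneg_left ?_ he
            exact_mod_cast card_le_card (filter_subset _ _)
    · refine sum_congr ?_ fun _ _ => rfl
      ext w
      simp [and_comm]
  calc l ^ 2 * x v = ∑ u ∈ G.neighborFinset v, ∑ w ∈ G.neighborFinset u, x w := by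
        rw [pow_two, mul_assoc, hx v, mul_sum]
        exact sum_congr rfl fun u _ => hx u
    _ ≤ ∑ u ∈ G.neighborFinset v, (e * #(G.neighborFinset u) +
          ∑ w ∈ {w ∈ univ.filter (fun w => e < x w) | G.Adj u w}, x w) :=
        sum_le_sum fun u _ => h1 u
    _ ≤ _ := by
        rw [sum_add_distrib, ← mul_sum, mul_assoc]
        exact add_le_add_left (mul_le_mul_of_nonneg_left (sum_degree_le hD _) he) _

/-- Entries are at most 1, so λx_v ≤ deg v; each counted vertex has degree at least λe, and all
degrees sum to at most Dn. -/
theorem card_large_mul_le (hD : ∀ X, degSum G X ≤ D * #X) (hx1 : ∀ v, x v ≤ 1) (hl : 0 ≤ l)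
    (hx : ∀ v, l * x v = ∑ u ∈ G.neighborFinset v, x u) (e : ℝ) :
    #(univ.filter (fun w => e < x w)) * (l * e) ≤ D * Fintype.card V := by
  refine le_trans ?_ (sum_degree_le hD (univ.filter (fun w => e < x w)))
  rw [← nsmul_eq_mul, ← sum_const]
  refine sum_le_sum fun v hv => ?_
  calc l * e ≤ l * x v := mul_le_mul_of_nonneg_left (mem_filter.1 hv).2.le hl
    _ = ∑ u ∈ G.neighborFinset v, x u := hx v
    _ ≤ ∑ u ∈ G.neighborFinset v, 1 := sum_le_sum fun u _ => hx1 u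
    _ = #(G.neighborFinset v) := by simp

/-- In a sparse graph of large spectral radius, the number of vertices whose eigenvector entry
exceeds a constant is bounded. -/
theorem card_large_mul_le_const (hD : ∀ X, degSum G X ≤ D * #X) (hD0 : 0 < D)
    (hx1 : ∀ v, x v ≤ 1) (hl : 0 ≤ l)
    (hx : ∀ v, l * x v = ∑ u ∈ G.neighborFinset v, x u) (hn : 0 < Fintype.card V)
    (hln : (Fintype.card V : ℝ) / 2 ≤ l ^ 2) {e : ℝ} (he : 0 < e)
    (hle : 64 * (D : ℝ) ^ 3 / e ^ 2 ≤ l) :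
    #(univ.filter (fun w => e < x w)) * e ≤ 4 * (D : ℝ) ^ 2 := by
  set n : ℝ := (Fintype.card V : ℝ) with hn'
  have hn0 : 0 < n := by rw [hn']; exact_mod_cast hn
  have hDr : (0 : ℝ) < D := by exact_mod_cast hD0
  -- Bootstrapping: the crude count at the lower threshold `e'` is o(n), so in the two-step equation
  -- the small entries and the count `m` each cost at most en/8 out of en/2. Every entry above `e`
  -- then forces linear degree.
  set e' : ℝ := e / (8 * D) with he'
  have he'0 : 0 < e' := by positivity
  set m : ℝ := (#(univ.filter (fun w => e' < x w)) : ℝ) with hm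
  have hm0 : 0 ≤ m := Nat.cast_nonneg _
  have h1 : D * m ≤ e * n / 8 := by
    have h2 : m * (l * e') ≤ D * n := card_large_mul_le hD hx1 hl hx e'
    have h3 : 8 * (D : ℝ) ^ 2 / e ≤ l * e' := by
      calc 8 * (D : ℝ) ^ 2 / e = (64 * (D : ℝ) ^ 3 / e ^ 2) * e' := by
            rw [he']; field_simp; norm_num
        _ ≤ l * e' := mul_le_mul_of_nonneg_right hle he'0.le
    have h4 : m * (8 * (D : ℝ) ^ 2 / e) ≤ D * n :=
      (mul_le_mul_of_nonneg_left h3 hm0).trans h2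
    have h5 : m * (8 * (D : ℝ) ^ 2 / e) = D * (8 * (D * m) / e) := by ring
    rw [h5] at h4
    have h6 := le_of_mul_le_mul_left h4 hDr
    rw [div_le_iff₀ he] at h6
    linarith
  have hdeg : ∀ v, e < x v → e * n / 4 ≤ D * (#(G.neighborFinset v) : ℝ) := by
    intro v hv
    have h2 := sq_mul_le hD hx he'0.le v
    have h3 : ∑ u ∈ G.neighborFinset v,
        ∑ w ∈ {w ∈ univ.filter (fun w => e' < x w) | G.Adj u w}, x w ≤
        D * (#(G.neighborFinset v) + m) := by
      refine le_trans (sum_le_sum fun u _ => ?_)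
        (sum_card_nbrs_in_le hD (G.neighborFinset v) (univ.filter (fun w => e' < x w)))
      refine (sum_le_sum fun w _ => hx1 w).trans ?_
      simp
    have h4 : e' * D * n = e * n / 8 := by rw [he']; field_simp
    have h5 : n / 2 * e ≤ l ^ 2 * x v :=
      mul_le_mul hln hv.le he.le (sq_nonneg _)
    rw [← hn', h4] at h2
    linarith
  have h2 : #(univ.filter (fun w => e < x w)) * (e * n / 4) ≤ D * (D * n) := by
    calc #(univ.filter (fun w => e < x w)) * (e * n / 4)
        = ∑ v ∈ univ.filter (fun w => e < x w), e * n / 4 := by rw [sum_const, nsmul_eq_mul]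
      _ ≤ ∑ v ∈ univ.filter (fun w => e < x w), D * (#(G.neighborFinset v) : ℝ) :=
          sum_le_sum fun v hv => hdeg v (mem_filter.1 hv).2
      _ ≤ D * (D * n) := by
          rw [← mul_sum]
          exact mul_le_mul_of_nonneg_left (sum_degree_le hD _) hDr.le
  refine le_of_mul_le_mul_right ?_ hn0
  linarith

/-- Without a large complete bipartite subgraph on `t + 1` vertices of one side, few vertices have
more than `t` neighbours in a bounded set. -/
theorem card_many_nbrs_le {t M : ℕ}
    (hM : ∀ S : Finset V, #S = t + 1 → #{b | ∀ a ∈ S, G.Adj a b} ≤ M) (L : Finset V) :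
    #{u | t < #{w ∈ L | G.Adj u w}} ≤ 2 ^ #L * M := by
  have hsub : ({u | t < #{w ∈ L | G.Adj u w}} : Finset V) ⊆
      (powersetCard (t + 1) L).biUnion fun S => {b | ∀ a ∈ S, G.Adj a b} := by
    intro u hu
    obtain ⟨S, hS, hSc⟩ := exists_subset_card_eq (mem_filter.1 hu).2
    refine mem_biUnion.2 ⟨S, mem_powersetCard.2 ⟨fun a ha => (mem_filter.1 (hS ha)).1, hSc⟩, ?_⟩
    exact mem_filter.2 ⟨mem_univ _, fun a ha => (mem_filter.1 (hS ha)).2.symm⟩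
  refine (card_le_card hsub).trans (card_biUnion_le.trans ?_)
  refine (sum_le_sum fun S hS => hM S (mem_powersetCard.1 hS).2).trans ?_
  rw [sum_const, smul_eq_mul]
  refine Nat.mul_le_mul_right _ ?_
  rw [← card_powerset]
  exact card_le_card fun S hS => mem_powerset.2 (mem_powersetCard.1 hS).1

/-- Vertices with at most `t` neighbours in `L` cost at most `c` each. The exceptions number at most
2^K · M and cost at most `K` each. -/
theorem sum_large_nbrs_le {t M K : ℕ}
    (hM : ∀ S : Finset V, #S = t + 1 → #{b | ∀ a ∈ S, G.Adj a b} ≤ M) {L : Finset V}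
    (hL : #L ≤ K) (hx1 : ∀ v, x v ≤ 1) {c : ℝ} (hc : 0 ≤ c)
    (h : ∀ u, #{w ∈ L | G.Adj u w} ≤ t → ∑ w ∈ {w ∈ L | G.Adj u w}, x w ≤ c) (X : Finset V) :
    ∑ u ∈ X, ∑ w ∈ {w ∈ L | G.Adj u w}, x w ≤ c * #X + K * (2 ^ K * M) := by
  have h1 : ∀ u, ∑ w ∈ {w ∈ L | G.Adj u w}, x w ≤
      c + if t < #{w ∈ L | G.Adj u w} then (K : ℝ) else 0 := by
    intro u
    by_cases hu : t < #{w ∈ L | G.Adj u w}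
    · rw [if_pos hu]
      have h2 : ∑ w ∈ {w ∈ L | G.Adj u w}, x w ≤ K := by
        refine (sum_le_sum fun w _ => hx1 w).trans ?_
        rw [sum_const, nsmul_eq_mul, mul_one]
        exact_mod_cast (card_le_card (filter_subset _ _)).trans hL
      linarith
    · rw [if_neg hu, add_zero]
      exact h u (not_lt.1 hu)
  refine (sum_le_sum fun u _ => h1 u).trans ?_
  rw [sum_add_distrib, sum_const, nsmul_eq_mul, mul_comm c]
  refine add_le_add_right ?_ _
  rw [← sum_filter, sum_const, nsmul_eq_mul, mul_comm]
  refine mul_le_mul_of_nonneg_left ?_ (Nat.cast_nonneg _)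
  have h3 : #{u ∈ X | t < #{w ∈ L | G.Adj u w}} ≤ 2 ^ K * M :=
    (card_le_card (filter_subset_filter _ (subset_univ X))).trans
      ((card_many_nbrs_le hM L).trans
        (Nat.mul_le_mul_right _ (Nat.pow_le_pow_right (by norm_num) hL)))
  exact_mod_cast h3

end Eigenvector

/-- A set `A` of `t` vertices with eigenvector entries close to `1` and almost all vertices as
common neighbours. All other entries are small. -/
theorem exists_dominating_set (t D M : ℕ) (ht : 1 ≤ t) (hD0 : 0 < D) (δ : ℝ) (hδ : 0 < δ)
    (hδ1 : δ < 1) :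
    ∃ N : ℕ, ∀ (V : Type*) [Fintype V], N ≤ Fintype.card V → ∀ (G : SimpleGraph V) (x : V → ℝ)
      (l : ℝ), (∀ v, 0 ≤ x v) → (∀ v, x v ≤ 1) → (∃ z, x z = 1) → 0 ≤ l →
      (∀ v, l * x v = ∑ u ∈ G.neighborFinset v, x u) →
      (t : ℝ) * (Fintype.card V - t) ≤ l ^ 2 →
      (∀ X, degSum G X ≤ D * #X) →
      (∀ S : Finset V, #S = t + 1 → #{b | ∀ a ∈ S, G.Adj a b} ≤ M) →
      ∃ A : Finset V, #A = t ∧ (∀ a ∈ A, 1 - δ ≤ x a) ∧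
        (1 - 2 * t * δ) * Fintype.card V ≤ #{b | ∀ a ∈ A, G.Adj a b} ∧
        ∀ v, v ∉ A → x v ≤ (2 + 4 * t ^ 2) * δ := by
  have hDr : (0 : ℝ) < D := by exact_mod_cast hD0
  have htr : (1 : ℝ) ≤ t := by exact_mod_cast ht
  -- Chosen so that the small entries contribute eDn = δn/2 to the two-step equation.
  set e : ℝ := δ / (2 * D) with he
  have he0 : 0 < e := by positivity
  set K : ℕ := ⌈4 * (D : ℝ) ^ 2 / e⌉₊ with hK
  set Q : ℝ := K * (2 ^ K * M) with hQ
  have hQ0 : 0 ≤ Q := by positivity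
  set Λ : ℝ := 64 * (D : ℝ) ^ 3 / e ^ 2 with hΛ
  have hΛ0 : 0 ≤ Λ := by positivity
  obtain ⟨N₁, hN₁⟩ := exists_nat_ge (2 * Λ ^ 2)
  obtain ⟨N₂, hN₂⟩ := exists_nat_gt (2 * (Q + t ^ 2 + t * M + t) / δ)
  refine ⟨max (2 * t) (max N₁ N₂), ?_⟩
  intro V _ hn G x l hx0 hx1 ⟨z, hz⟩ hl hx hlt hD hM
  have hn1 : 2 * t ≤ Fintype.card V := (le_max_left _ _).trans hn
  have hn2 : N₁ ≤ Fintype.card V := ((le_max_left _ _).trans (le_max_right _ _)).trans hn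
  have hn3 : N₂ ≤ Fintype.card V := ((le_max_right _ _).trans (le_max_right _ _)).trans hn
  have hncard : 0 < Fintype.card V := by omega
  set n : ℝ := (Fintype.card V : ℝ) with hn'
  have hn0 : 0 < n := by rw [hn']; exact_mod_cast hncard
  have h2t : 2 * (t : ℝ) ≤ n := by rw [hn']; exact_mod_cast hn1
  have hNΛ : 2 * Λ ^ 2 ≤ n := hN₁.trans (by rw [hn']; exact_mod_cast hn2)
  have hNδ : 2 * (Q + t ^ 2 + t * M + t) < δ * n := by
    have h : 2 * (Q + t ^ 2 + t * M + t) / δ < n :=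
      hN₂.trans_le (by rw [hn']; exact_mod_cast hn3)
    rw [div_lt_iff₀ hδ] at h
    linarith
  have hln : n / 2 ≤ l ^ 2 := by nlinarith
  have hlΛ : Λ ≤ l := by
    refine le_of_sq_le_sq ?_ hl
    linarith
  set L : Finset V := univ.filter (fun w => e < x w) with hL
  have hLK : #L ≤ K := by
    have h := card_large_mul_le_const hD hD0 hx1 hl hx hncard hln he0 hlΛ
    rw [← le_div_iff₀ he0] at h
    have h' := h.trans (Nat.le_ceil _)
    rw [hL, hK]
    exact_mod_cast h'
  have heD : e * D * n = δ * n / 2 := by rw [he]; field_simp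
  have hup : ∀ v, l ^ 2 * x v ≤ δ * n / 2 + t * #(G.neighborFinset v) + Q := by
    intro v
    have h1 := sq_mul_le hD hx he0.le v
    have h2 := sum_large_nbrs_le (c := t) hM hLK hx1 (by positivity) (fun u hu => by
      refine (sum_le_sum fun w _ => hx1 w).trans ?_
      rw [sum_const, nsmul_eq_mul, mul_one]
      exact_mod_cast hu) (G.neighborFinset v)
    rw [← hn', heD] at h1
    linarith
  set A' : Finset V := univ.filter (fun v => 1 - δ ≤ x v) with hA'
  have hA't : t ≤ #A' := by
    -- Otherwise any `t` large neighbours of `u` include one with entry below 1 - δ, so their sum is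
    -- at most t - δ. At `z` this gives λ² ≤ (t - δ/2)n + Q, below t(n - t) for large n.
    by_contra! hlt'
    have h1 := sq_mul_le hD hx he0.le z
    have h2 := sum_large_nbrs_le (c := t - δ) hM hLK hx1 (by linarith) (fun u hu => by
      set W : Finset V := {w ∈ L | G.Adj u w} with hW
      rcases hu.lt_or_eq with hu | hu
      · have h3 : ((#W : ℕ) : ℝ) + 1 ≤ t := by exact_mod_cast hu
        refine (sum_le_sum fun w _ => hx1 w).trans ?_
        rw [sum_const, nsmul_eq_mul, mul_one]
        linarith
      · obtain ⟨w, hw, hwA⟩ := exists_mem_notMem_of_card_lt_card (hlt'.trans_eq hu.symm)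
        have h3 : x w < 1 - δ := by
          by_contra! h
          exact hwA (mem_filter.2 ⟨mem_univ _, h⟩)
        rw [← add_sum_erase W x hw]
        have h4 : ∑ y ∈ W.erase w, x y ≤ #(W.erase w) := by
          refine (sum_le_sum fun w _ => hx1 w).trans ?_
          simp
        have h5 : (#(W.erase w) : ℝ) + 1 = t := by
          exact_mod_cast (card_erase_add_one hw).trans hu
        linarith) (G.neighborFinset z)
    rw [← hn', heD, hz, mul_one] at h1
    have h3 : (#(G.neighborFinset z) : ℝ) ≤ n := by
      rw [hn']; exact_mod_cast card_le_univ _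
    have h4 : (t - δ) * (#(G.neighborFinset z) : ℝ) ≤ (t - δ) * n :=
      mul_le_mul_of_nonneg_left h3 (by linarith)
    have h5 : 0 ≤ (t : ℝ) * M := by positivity
    linarith
  obtain ⟨A, hAA', hAt⟩ := exists_subset_card_eq hA't
  have hAx : ∀ a ∈ A, 1 - δ ≤ x a := fun a ha => (mem_filter.1 (hAA' ha)).2
  set B : Finset V := {b | ∀ a ∈ A, G.Adj a b} with hB
  have htM : 0 ≤ (t : ℝ) * M := by positivity
  have hdeg : ∀ a ∈ A, (1 - 2 * δ) * n ≤ #(G.neighborFinset a) := by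
    intro a ha
    have h1 := hup a
    have h2 : (t : ℝ) * (n - t) * (1 - δ) ≤ l ^ 2 * x a :=
      mul_le_mul hlt (hAx a ha) (by linarith) (sq_nonneg _)
    have h3 : δ * n / 2 ≤ t * (δ * n / 2) := le_mul_of_one_le_left (by positivity) htr
    have h4 : t * ((1 - 2 * δ) * n) ≤ t * #(G.neighborFinset a) := by
      have h5 : 0 ≤ (t : ℝ) ^ 2 * δ := by positivity
      have h6 : 0 ≤ (t : ℝ) := by positivity
      linarith
    exact le_of_mul_le_mul_left h4 (by linarith)
  have hBc : (#Bᶜ : ℝ) ≤ 2 * t * δ * n := by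
    have hsub : Bᶜ ⊆ A.biUnion fun a => (G.neighborFinset a)ᶜ := by
      intro v hv
      simp only [hB, mem_compl, mem_filter, mem_univ, true_and, not_forall] at hv
      obtain ⟨a, ha, hav⟩ := hv
      exact mem_biUnion.2 ⟨a, ha, by simpa using hav⟩
    have h1 : #Bᶜ ≤ ∑ a ∈ A, #(G.neighborFinset a)ᶜ := (card_le_card hsub).trans card_biUnion_le
    have h2 : (#Bᶜ : ℝ) ≤ ∑ a ∈ A, (#(G.neighborFinset a)ᶜ : ℝ) := by exact_mod_cast h1
    refine h2.trans ((sum_le_sum (g := fun _ => 2 * δ * n) fun a ha => ?_).trans (le_of_eq ?_))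
    · have h3 : (#(G.neighborFinset a) : ℝ) + #(G.neighborFinset a)ᶜ = n := by
        rw [hn']; exact_mod_cast card_add_card_compl (G.neighborFinset a)
      have := hdeg a ha
      linarith
    · rw [sum_const, nsmul_eq_mul, hAt]; ring
  refine ⟨A, hAt, hAx, ?_, fun v hv => ?_⟩
  · have h3 : (#B : ℝ) + #Bᶜ = n := by
      rw [hn']; exact_mod_cast card_add_card_compl B
    linarith
  · have h1 : #{b ∈ B | G.Adj v b} ≤ M := by
      refine (card_le_card fun b hb => ?_).trans
        (hM (insert v A) (by rw [card_insert_of_notMem hv, hAt]))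
      obtain ⟨hb, hvb⟩ := mem_filter.1 hb
      refine mem_filter.2 ⟨mem_univ _, fun a ha => ?_⟩
      rcases mem_insert.1 ha with rfl | ha
      · exact hvb
      · exact (mem_filter.1 hb).2 a ha
    have h2 : #(G.neighborFinset v) ≤ M + #Bᶜ := by
      have hsub : G.neighborFinset v ⊆ {b ∈ B | G.Adj v b} ∪ Bᶜ := by
        intro b hb
        by_cases h : b ∈ B
        · exact mem_union_left _ (mem_filter.2 ⟨h, by simpa using hb⟩)
        · exact mem_union_right _ (mem_compl.2 h)
      exact (card_le_card hsub).trans ((card_union_le _ _).trans (Nat.add_le_add_right h1 _))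
    have h3 : (#(G.neighborFinset v) : ℝ) ≤ M + 2 * t * δ * n := by
      have : (#(G.neighborFinset v) : ℝ) ≤ M + #Bᶜ := by exact_mod_cast h2
      linarith
    have h4 := hup v
    have h5 : (t : ℝ) * #(G.neighborFinset v) ≤ t * (M + 2 * t * δ * n) :=
      mul_le_mul_of_nonneg_left h3 (by linarith)
    have h6 : n / 2 * x v ≤ l ^ 2 * x v := mul_le_mul_of_nonneg_right hln (hx0 v)
    have h7 : 0 ≤ (t : ℝ) ^ 2 := by positivity
    have h8 : n * x v ≤ n * ((2 + 4 * t ^ 2) * δ) := by linarith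
    exact le_of_mul_le_mul_left h8 hn0

/-! ### Comparison with the join over A -/

theorem adjForm_eq_sum_ite {V : Type*} [Fintype V] (G : SimpleGraph V) (x : V → ℝ) :
    adjForm G x = ∑ u, ∑ v, (if G.Adj u v then 1 else 0) * (x u * x v) := by
  refine sum_congr rfl fun u _ => ?_
  rw [mul_sum]
  simp only [ite_mul, one_mul, zero_mul]
  rw [← sum_filter]
  refine sum_congr ?_ fun _ _ => rfl
  ext v
  simp

/-- In a sparse graph the sum of `x u * x v` over edges `u v` is controlled by the sum of `x`. -/
theorem sum_adj_mul_le {V : Type*} {G : SimpleGraph V} {D : ℕ} {x : V → ℝ} {η : ℝ}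
    (hD : ∀ X, degSum G X ≤ D * #X) :
    ∀ X : Finset V, (∀ v ∈ X, 0 ≤ x v) → (∀ v ∈ X, x v ≤ η) →
      ∑ u ∈ X, ∑ v ∈ X, (if G.Adj u v then 1 else 0) * (x u * x v) ≤
        2 * D * η * ∑ v ∈ X, x v := by
  intro X
  induction hn : #X generalizing X with
  | zero =>
    intro _ _
    rw [card_eq_zero.1 hn]
    simp
  | succ k ih =>
    -- Degeneracy: some `w` has at most `D` neighbours in `X`. Removing it costs at most Dη · x_w in
    -- each of the two orders, whence the factor 2.
    intro h0 hη
    have hw : ∃ w ∈ X, #{u ∈ X | G.Adj w u} ≤ D := by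
      by_contra! h
      have h1 : ∑ w ∈ X, D < degSum G X :=
        sum_lt_sum_of_nonempty (card_pos.1 (by omega)) fun w hw => h w hw
      rw [sum_const, smul_eq_mul, mul_comm] at h1
      exact absurd (hD X) (not_le.2 h1)
    obtain ⟨w, hw, hwd⟩ := hw
    have hY := ih (X.erase w) (by rw [card_erase_of_mem hw, hn]; rfl)
      (fun v hv => h0 v (mem_of_mem_erase hv)) (fun v hv => hη v (mem_of_mem_erase hv))
    set Y := X.erase w with hYdef
    have hX : X = insert w Y := (insert_erase hw).symm
    have hwY : w ∉ Y := notMem_erase w X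
    have hη0 : 0 ≤ η := (h0 w hw).trans (hη w hw)
    have h1 : ∑ v ∈ Y, (if G.Adj w v then 1 else 0) * (x w * x v) ≤ x w * (D * η) := by
      have h2 : ∑ v ∈ Y, (if G.Adj w v then 1 else 0) * (x w * x v) =
          x w * ∑ v ∈ {v ∈ Y | G.Adj w v}, x v := by
        rw [sum_filter, mul_sum]
        refine sum_congr rfl fun v _ => ?_
        split_ifs <;> simp
      rw [h2]
      refine mul_le_mul_of_nonneg_left ?_ (h0 w hw)
      calc ∑ v ∈ {v ∈ Y | G.Adj w v}, x v ≤ ∑ v ∈ {v ∈ Y | G.Adj w v}, η :=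
            sum_le_sum fun v hv => hη v (mem_of_mem_erase (mem_filter.1 hv).1)
        _ = #{v ∈ Y | G.Adj w v} * η := by rw [sum_const, nsmul_eq_mul]
        _ ≤ D * η := by
            refine mul_le_mul_of_nonneg_right ?_ hη0
            exact_mod_cast (card_le_card (filter_subset_filter _ (erase_subset w X))).trans hwd
    have h3 : ∑ u ∈ Y, (if G.Adj u w then 1 else 0) * (x u * x w) =
        ∑ v ∈ Y, (if G.Adj w v then 1 else 0) * (x w * x v) := by
      refine sum_congr rfl fun v _ => ?_
      rw [G.adj_comm, mul_comm (x v)]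
    rw [hX, sum_insert hwY, sum_insert hwY, sum_insert hwY]
    have h4 : ∑ u ∈ Y, ∑ v ∈ insert w Y, (if G.Adj u v then 1 else 0) * (x u * x v) =
        ∑ u ∈ Y, (if G.Adj u w then 1 else 0) * (x u * x w) +
          ∑ u ∈ Y, ∑ v ∈ Y, (if G.Adj u v then 1 else 0) * (x u * x v) := by
      rw [← sum_add_distrib]
      exact sum_congr rfl fun u _ => sum_insert hwY
    rw [h4, h3, if_neg (G.loopless.irrefl w)]
    linarith

/-- Comparison of `G` with a graph `T` in which `A` is joined to everything and which contains the
edges of `G` between the common neighbours of `A`. -/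
theorem eq_of_lam_le {V : Type*} [Fintype V] {G T : SimpleGraph V} {D : ℕ} {x : V → ℝ}
    {A : Finset V} {δ η : ℝ} (hx0 : ∀ v, 0 ≤ x v)
    (hx : ∀ v, lam G * x v = ∑ u ∈ G.neighborFinset v, x u) (hD : ∀ X, degSum G X ≤ D * #X)
    (hA : A.Nonempty) (hAx : ∀ a ∈ A, 1 - δ ≤ x a) (hxη : ∀ v, v ∉ A → x v ≤ η) (hη : 0 ≤ η)
    (hδη : (D + 2) * η < 1 - δ)
    (hB : ∀ v, v ∉ A →
      #{b ∈ (univ.filter fun b => ∀ a ∈ A, G.Adj a b) | G.Adj v b} ≤ 2)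
    (hTA : ∀ a ∈ A, ∀ v, v ≠ a → T.Adj a v)
    (hTB : ∀ u v, (∀ a ∈ A, G.Adj a u) → (∀ a ∈ A, G.Adj a v) → G.Adj u v → T.Adj u v)
    (hlam : lam T ≤ lam G) : G = T := by
  have hV : Nonempty V := ⟨hA.choose⟩
  set B : Finset V := univ.filter fun b => ∀ a ∈ A, G.Adj a b with hBdef
  have hBA : ∀ b ∈ B, b ∉ A := fun b hb hbA => ((mem_filter.1 hb).2 b hbA).ne rfl
  set R : Finset V := univ.filter fun v => v ∉ A ∧ v ∉ B with hRdef
  have hRA : ∀ v ∈ R, v ∉ A := fun v hv => (mem_filter.1 hv).2.1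
  have hRB : ∀ v ∈ R, v ∉ B := fun v hv => (mem_filter.1 hv).2.2
  have hABR : ∀ v, v ∈ A ∨ v ∈ B ∨ v ∈ R := fun v => by simp only [hRdef, mem_filter, mem_univ, true_and]; tauto
  have hδ0 : 0 < 1 - δ := lt_of_le_of_lt (by positivity) hδη
  have hex : ∀ v, ∃ a, v ∈ R → a ∈ A ∧ ¬ G.Adj a v := by
    intro v
    by_cases hv : v ∈ R
    · have h := hRB v hv
      simp only [hBdef, mem_filter, mem_univ, true_and, not_forall] at h
      obtain ⟨a, ha, hav⟩ := h
      exact ⟨a, fun _ => ⟨ha, hav⟩⟩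
    · exact ⟨v, fun h => absurd h hv⟩
  choose a ha using hex
  set sR : ℝ := ∑ v ∈ R, x v with hsR
  -- Sums run over ordered pairs. The chosen missing pairs at `R` lie in `T` but not in `G`, and an
  -- edge of `G` outside `T` lies inside `R` or between `R` and `B`.
  have hpt : ∀ u v, (if v ∈ R ∧ u = a v then (1 : ℝ) else 0) + (if u ∈ R ∧ v = a u then 1 else 0) +
      (if G.Adj u v then 1 else 0) ≤ (if T.Adj u v then 1 else 0) +
      (if u ∈ R ∧ v ∈ R ∧ G.Adj u v then 1 else 0) +
      (if u ∈ R ∧ v ∈ B ∧ G.Adj u v then 1 else 0) +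
      (if v ∈ R ∧ u ∈ B ∧ G.Adj v u then 1 else 0) := by
    intro u v
    have hnn : ∀ (P : Prop) [Decidable P], (0 : ℝ) ≤ if P then 1 else 0 := fun P _ => by
      split_ifs <;> norm_num
    by_cases h1 : v ∈ R ∧ u = a v
    · obtain ⟨hv, rfl⟩ := h1
      obtain ⟨h2, h3⟩ := ha v hv
      have h4 : a v ∉ R := fun h => hRA _ h h2
      have h5 : T.Adj (a v) v := hTA _ h2 v fun e => h4 (e ▸ hv)
      rw [if_pos ⟨hv, rfl⟩, if_neg (fun h => h4 h.1), if_neg h3, if_pos h5]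
      linarith [hnn (a v ∈ R ∧ v ∈ R ∧ G.Adj (a v) v), hnn (a v ∈ R ∧ v ∈ B ∧ G.Adj (a v) v),
        hnn (v ∈ R ∧ a v ∈ B ∧ G.Adj v (a v))]
    by_cases h1' : u ∈ R ∧ v = a u
    · obtain ⟨hu, rfl⟩ := h1'
      obtain ⟨h2, h3⟩ := ha u hu
      have h4 : a u ∉ R := fun h => hRA _ h h2
      have h5 : T.Adj u (a u) := (hTA _ h2 u fun e => h4 (by rwa [← e])).symm
      rw [if_neg h1, if_pos ⟨hu, rfl⟩, if_neg (fun h => h3 h.symm), if_pos h5]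
      linarith [hnn (u ∈ R ∧ a u ∈ R ∧ G.Adj u (a u)), hnn (u ∈ R ∧ a u ∈ B ∧ G.Adj u (a u)),
        hnn (a u ∈ R ∧ u ∈ B ∧ G.Adj (a u) u)]
    rw [if_neg h1, if_neg h1']
    have n1 := hnn (T.Adj u v)
    have n2 := hnn (u ∈ R ∧ v ∈ R ∧ G.Adj u v)
    have n3 := hnn (u ∈ R ∧ v ∈ B ∧ G.Adj u v)
    have n4 := hnn (v ∈ R ∧ u ∈ B ∧ G.Adj v u)
    by_cases hG : G.Adj u v
    · rw [if_pos hG]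
      have hT : u ∈ A ∨ v ∈ A ∨ (u ∈ B ∧ v ∈ B) → T.Adj u v := by
        rintro (h | h | ⟨h, h'⟩)
        · exact hTA u h v hG.ne'
        · exact (hTA v h u hG.ne).symm
        · exact hTB u v (mem_filter.1 h).2 (mem_filter.1 h').2 hG
      rcases hABR u with hu | hu | hu
      · rw [if_pos (hT (Or.inl hu))]; linarith
      · rcases hABR v with hv | hv | hv
        · rw [if_pos (hT (Or.inr (Or.inl hv)))]; linarith
        · rw [if_pos (hT (Or.inr (Or.inr ⟨hu, hv⟩)))]; linarith
        · rw [if_pos (⟨hv, hu, hG.symm⟩ : v ∈ R ∧ u ∈ B ∧ G.Adj v u)]; linarith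
      · rcases hABR v with hv | hv | hv
        · rw [if_pos (hT (Or.inr (Or.inl hv)))]; linarith
        · rw [if_pos (⟨hu, hv, hG⟩ : u ∈ R ∧ v ∈ B ∧ G.Adj u v)]; linarith
        · rw [if_pos (⟨hu, hv, hG⟩ : u ∈ R ∧ v ∈ R ∧ G.Adj u v)]; linarith
    · rw [if_neg hG]; linarith
  have hsum := sum_le_sum fun u (_ : u ∈ univ) => sum_le_sum fun v (_ : v ∈ univ) =>
    mul_le_mul_of_nonneg_right (hpt u v) (mul_nonneg (hx0 u) (hx0 v))
  simp only [add_mul, sum_add_distrib, ← adjForm_eq_sum_ite] at hsum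
  have hmiss : ∑ u, ∑ v, (if u ∈ R ∧ v = a u then (1 : ℝ) else 0) * (x u * x v) =
      ∑ u ∈ R, x u * x (a u) := by
    rw [← sum_subset (subset_univ R)]
    · refine sum_congr rfl fun u hu => ?_
      simp [hu]
    · intro u _ hu
      simp [hu]
  have hmiss' : ∑ u, ∑ v, (if v ∈ R ∧ u = a v then (1 : ℝ) else 0) * (x u * x v) =
      ∑ u ∈ R, x u * x (a u) := by
    rw [sum_comm, ← hmiss]
    exact sum_congr rfl fun u _ => sum_congr rfl fun v _ => by rw [mul_comm (x u)]
  have hmissle : (1 - δ) * sR ≤ ∑ u ∈ R, x u * x (a u) := by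
    rw [hsR, mul_sum]
    refine sum_le_sum fun u hu => ?_
    rw [mul_comm]
    exact mul_le_mul_of_nonneg_left (hAx _ (ha u hu).1) (hx0 u)
  have hRR : ∑ u, ∑ v, (if u ∈ R ∧ v ∈ R ∧ G.Adj u v then (1 : ℝ) else 0) * (x u * x v) ≤
      2 * D * η * sR := by
    refine le_trans (le_of_eq ?_) (sum_adj_mul_le hD R (fun v _ => hx0 v)
      fun v hv => hxη v (hRA v hv))
    rw [← sum_subset (subset_univ R)]
    · refine sum_congr rfl fun u hu => ?_
      rw [← sum_subset (subset_univ R)]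
      · refine sum_congr rfl fun v hv => ?_
        simp [hu, hv]
      · intro v _ hv
        simp [hv]
    · intro u _ hu
      simp [hu]
  have hRBs : ∑ u, ∑ v, (if u ∈ R ∧ v ∈ B ∧ G.Adj u v then (1 : ℝ) else 0) * (x u * x v) ≤
      2 * η * sR := by
    rw [← sum_subset (subset_univ R), hsR, mul_sum]
    · refine sum_le_sum fun u hu => ?_
      have h1 : ∑ v, (if u ∈ R ∧ v ∈ B ∧ G.Adj u v then (1 : ℝ) else 0) * (x u * x v) =
          x u * ∑ v ∈ {b ∈ B | G.Adj u b}, x v := by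
        rw [mul_sum, ← sum_subset (subset_univ {b ∈ B | G.Adj u b})]
        · refine sum_congr rfl fun v hv => ?_
          obtain ⟨hv, huv⟩ := mem_filter.1 hv
          rw [if_pos ⟨hu, hv, huv⟩, one_mul]
        · intro v _ hv
          rw [if_neg fun h => hv (mem_filter.2 h.2), zero_mul]
      rw [h1, mul_comm (2 * η)]
      refine mul_le_mul_of_nonneg_left ?_ (hx0 u)
      calc ∑ v ∈ {b ∈ B | G.Adj u b}, x v ≤ ∑ v ∈ {b ∈ B | G.Adj u b}, η :=
            sum_le_sum fun v hv => hxη v (hBA v (mem_filter.1 hv).1)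
        _ = #{b ∈ B | G.Adj u b} * η := by rw [sum_const, nsmul_eq_mul]
        _ ≤ 2 * η := by
            refine mul_le_mul_of_nonneg_right ?_ hη
            exact_mod_cast hB u (hRA u hu)
    · intro u _ hu
      simp [hu]
  have hRBs' : ∑ u, ∑ v, (if v ∈ R ∧ u ∈ B ∧ G.Adj v u then (1 : ℝ) else 0) * (x u * x v) ≤
      2 * η * sR := by
    rw [sum_comm]
    refine le_trans (le_of_eq ?_) hRBs
    exact sum_congr rfl fun u _ => sum_congr rfl fun v _ => by rw [mul_comm (x u)]
  have hfG : adjForm G x = lam G * ∑ v, x v ^ 2 := adjForm_of_eigen G x _ hx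
  have hfT : adjForm T x ≤ lam T * ∑ v, x v ^ 2 := adjForm_le T x
  have hsq : 0 ≤ ∑ v, x v ^ 2 := sum_nonneg fun v _ => sq_nonneg _
  have hTG : lam T * ∑ v, x v ^ 2 ≤ lam G * ∑ v, x v ^ 2 := mul_le_mul_of_nonneg_right hlam hsq
  have hsR0 : 0 ≤ sR := sum_nonneg fun v _ => hx0 v
  -- The gain is at least 2(1 - δ)·`sR` and the loss at most (2D + 4)η·`sR`, so `hδη` leaves only
  -- `sR` = 0.
  have hsR00 : sR = 0 := by
    by_contra h
    have hpos : 0 < sR := lt_of_le_of_ne hsR0 (Ne.symm h)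
    have := mul_lt_mul_of_pos_right hδη hpos
    rw [hmiss, hmiss'] at hsum
    linarith
  have hTeig : ∀ v, lam T * x v = ∑ u ∈ T.neighborFinset v, x u := by
    refine eigen_of_adjForm_eq T x ?_
    rw [hmiss, hmiss'] at hsum
    rw [hsR00] at hmissle hRR hRBs hRBs'
    linarith
  have hApos : ∀ b ∈ A, 0 < x b := fun b hb => hδ0.trans_le (hAx b hb)
  -- In `T` each vertex off `A` has a neighbour in `A`, where `x` is positive; the eigenvector
  -- equation of `T` excludes zeros. With `sR` = 0 this empties `R`.
  have hpos : ∀ v, 0 < x v := by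
    intro v
    by_cases hv : v ∈ A
    · exact hApos v hv
    refine lt_of_le_of_ne (hx0 v) fun h0 => ?_
    have h1 := hTeig v
    rw [← h0, mul_zero] at h1
    obtain ⟨b, hb⟩ := hA
    have h2 : x b ≤ ∑ u ∈ T.neighborFinset v, x u := by
      refine single_le_sum (f := x) (fun u _ => hx0 u) ?_
      rw [mem_neighborFinset]
      exact (hTA b hb v fun e => hv (e ▸ hb)).symm
    linarith [hApos b hb]
  have hRe : ∀ v, v ∉ R := by
    intro v hv
    have h1 := (sum_eq_zero_iff_of_nonneg fun v _ => hx0 v).1 hsR00 v hv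
    exact (hpos v).ne' h1
  have hle : G ≤ T := by
    intro u v hG
    rcases hABR u with hu | hu | hu
    · exact hTA u hu v hG.ne'
    · rcases hABR v with hv | hv | hv
      · exact (hTA v hv u hG.ne).symm
      · exact hTB u v (mem_filter.1 hu).2 (mem_filter.1 hv).2 hG
      · exact absurd hv (hRe v)
    · exact absurd hu (hRe u)
  -- An extra edge uw of `T` would raise the neighbour sum at `u` by x_w > 0, against λ(T) ≤ λ(G).
  refine le_antisymm hle fun u w hT => ?_
  by_contra hG
  have h1 : x w + ∑ v ∈ G.neighborFinset u, x v ≤ ∑ v ∈ T.neighborFinset u, x v := by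
    rw [← sum_insert (by simpa using hG)]
    refine sum_le_sum_of_subset_of_nonneg (fun v hv => ?_) fun v _ _ => hx0 v
    rw [mem_neighborFinset]
    rcases mem_insert.1 hv with rfl | hv
    · exact hT
    · exact hle (by simpa using hv)
  rw [← hx u, ← hTeig u] at h1
  have h2 := mul_le_mul_of_nonneg_right hlam (hx0 u)
  linarith [hpos w]

/-! ### Copies of the extremal graphs on the vertex set of G -/

/-- The spectral radius of a join with a complete graph is at least that of the complete bipartite
graph between the two sides. -/
theorem sqrt_le_lam_join {t : ℕ} {Y : Type*} [Fintype Y] [Nonempty Y] (ht : 0 < t)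
    (H : SimpleGraph Y) :
    √((t : ℝ) * Fintype.card Y) ≤ lam (join (⊤ : SimpleGraph (Fin t)) H) := by
  have hA : #((univ : Finset (Fin t)).map (Function.Embedding.inl (β := Y))) = t := by simp
  have h := sqrt_le_lam (join (⊤ : SimpleGraph (Fin t)) H)
    ((univ : Finset (Fin t)).map Function.Embedding.inl) (by rw [hA]; exact ht)
    (by rw [hA, Fintype.card_sum, Fintype.card_fin]; linarith [Fintype.card_pos (α := Y)]) ?_
  · rwa [hA, Fintype.card_sum, Fintype.card_fin, Nat.add_sub_cancel_left] at h
  · intro a ha v hv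
    obtain ⟨i, -, rfl⟩ := mem_map.1 ha
    rcases v with j | y
    · exact absurd (mem_map.2 ⟨j, mem_univ j, rfl⟩) hv
    · simp [join]

/-- Placing the join of a complete graph and `H` on a vertex set, with prescribed positions. -/
theorem exists_placement {V Y : Type*} [Fintype V] [Fintype Y] {t : ℕ} {A : Finset V}
    (hA : #A = t) (H : SimpleGraph Y) {f : Y → V} (hfi : Function.Injective f)
    (hf : ∀ v, v ∉ A ↔ ∃ y, f y = v) :
    ∃ T : SimpleGraph V, Nonempty (T ≃g join (⊤ : SimpleGraph (Fin t)) H) ∧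
      (∀ a ∈ A, ∀ v, v ≠ a → T.Adj a v) ∧ ∀ y y', H.Adj y y' → T.Adj (f y) (f y') := by
  set g : Fin t → V := fun i => (A.equivFinOfCardEq hA).symm i with hg
  have hgA : ∀ i, g i ∈ A := fun i => ((A.equivFinOfCardEq hA).symm i).2
  have hbij : Function.Bijective (Sum.elim g f) := by
    constructor
    · refine Function.Injective.sumElim ?_ hfi fun i y h => ?_
      · exact Subtype.val_injective.comp (Equiv.injective _)
      · exact (hf (f y)).2 ⟨y, rfl⟩ (h ▸ hgA i)
    · intro v
      by_cases hv : v ∈ A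
      · exact ⟨Sum.inl (A.equivFinOfCardEq hA ⟨v, hv⟩), by simp [hg]⟩
      · obtain ⟨y, rfl⟩ := (hf v).1 hv
        exact ⟨Sum.inr y, rfl⟩
  set φ : Fin t ⊕ Y ≃ V := Equiv.ofBijective _ hbij with hφ
  have hφr : ∀ y, φ.symm (f y) = Sum.inr y := fun y => by
    rw [Equiv.symm_apply_eq]; rfl
  have hφl : ∀ a ∈ A, ∃ i, φ.symm a = Sum.inl i := by
    intro a ha
    rcases h : φ.symm a with i | y
    · exact ⟨i, rfl⟩
    · rw [Equiv.symm_apply_eq] at h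
      exact absurd ha ((hf a).2 ⟨y, h.symm⟩)
  refine ⟨(join ⊤ H).comap φ.symm, ⟨Iso.comap φ.symm _⟩, fun a ha v hv => ?_, fun y y' h => ?_⟩
  · rw [comap_adj]
    have hne : φ.symm v ≠ φ.symm a := fun h => hv (φ.symm.injective h)
    obtain ⟨i, hi⟩ := hφl a ha
    rw [hi] at hne ⊢
    rcases hj : φ.symm v with j | y
    · have : i ≠ j := fun e => hne (hj.trans (congrArg Sum.inl e.symm))
      simp [join, this]
    · simp [join]
  · rw [comap_adj, hφr, hφr]
    simp [join, h]

/-- A relation of maximum degree one on a finite set is contained in a maximum matching. -/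
theorem exists_matching_extension {V : Type*} {E : V → V → Prop} (hs : ∀ u v, E u v → E v u)
    (hi : ∀ u, ¬ E u u) (hE : ∀ u v w, E u v → E u w → v = w) {q : ℕ} (hq : q ≤ 1) (p : ℕ) :
    ∀ X : Finset V, #X = p * 2 + q → ∃ f : (Fin p × Fin 2) ⊕ Fin q → V,
      (∀ y, f y ∈ X) ∧ (∀ v ∈ X, ∃ y, f y = v) ∧
      ∀ u ∈ X, ∀ v ∈ X, E u v → ∃ i a b, a ≠ b ∧ f (Sum.inl (i, a)) = u ∧
        f (Sum.inl (i, b)) = v := by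
  induction p with
  | zero =>
    intro X hX
    have e : Fin q ≃ X := (X.equivFinOfCardEq (by omega : #X = q)).symm
    refine ⟨Sum.elim (fun i => i.1.elim0) fun j => e j, ?_, fun v hv => ?_, fun u hu v hv h => ?_⟩
    · rintro (⟨i, -⟩ | j)
      · exact i.elim0
      · exact (e j).2
    · exact ⟨Sum.inr (e.symm ⟨v, hv⟩), by simp⟩
    · have : u = v := card_le_one.1 (by omega) u hu v hv
      exact absurd (this ▸ h) (hi _)
  | succ p ih =>
    intro X hX
    -- An edge of `E` if there is one, otherwise any two vertices. Either way no `E`-edge joins the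
    -- pair to the rest of `X`.
    have huv : ∃ u ∈ X, ∃ v ∈ X, u ≠ v ∧ (∀ w ∈ X, E u w → w = v) ∧ ∀ w ∈ X, E v w → w = u := by
      by_cases h : ∃ u ∈ X, ∃ v ∈ X, E u v
      · obtain ⟨u, hu, v, hv, huv⟩ := h
        exact ⟨u, hu, v, hv, fun e => hi u (by rwa [← e] at huv),
          fun w _ hw => hE u w v hw huv, fun w _ hw => hE v w u hw (hs u v huv)⟩
      · push Not at h
        obtain ⟨u, hu, v, hv, huv⟩ := one_lt_card.1 (by omega : 1 < #X)
        exact ⟨u, hu, v, hv, huv, fun w hw h' => absurd h' (h u hu w hw),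
          fun w hw h' => absurd h' (h v hv w hw)⟩
    obtain ⟨u, hu, v, hv, huv, hEu, hEv⟩ := huv
    obtain ⟨f, hf1, hf2, hf3⟩ := ih ((X.erase u).erase v) (by
      rw [card_erase_of_mem (mem_erase.2 ⟨huv.symm, hv⟩), card_erase_of_mem hu]
      omega)
    have hX' : ∀ w, w ∈ (X.erase u).erase v ↔ w ≠ v ∧ w ≠ u ∧ w ∈ X := by simp
    set f' : (Fin (p + 1) × Fin 2) ⊕ Fin q → V := Sum.elim
      (fun y => Fin.cases (if y.2 = 0 then u else v) (fun i => f (Sum.inl (i, y.2))) y.1)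
      fun j => f (Sum.inr j) with hf'
    have e0 : f' (Sum.inl (0, 0)) = u := rfl
    have e1 : f' (Sum.inl (0, 1)) = v := rfl
    have es : ∀ i a, f' (Sum.inl (Fin.succ i, a)) = f (Sum.inl (i, a)) := fun i a => rfl
    refine ⟨f', ?_, fun w hw => ?_, fun x hx y hy hxy => ?_⟩
    · rintro (⟨i, a⟩ | j)
      · refine Fin.cases ?_ (fun i => ?_) i
        · change (if a = 0 then u else v) ∈ X
          split_ifs
          exacts [hu, hv]
        · rw [es]
          exact ((hX' _).1 (hf1 _)).2.2
      · exact ((hX' _).1 (hf1 (Sum.inr j))).2.2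
    · by_cases hwu : w = u
      · exact ⟨_, hwu ▸ e0⟩
      by_cases hwv : w = v
      · exact ⟨_, hwv ▸ e1⟩
      obtain ⟨y, hy⟩ := hf2 w ((hX' w).2 ⟨hwv, hwu, hw⟩)
      rcases y with ⟨i, a⟩ | j
      · exact ⟨Sum.inl (i.succ, a), hy⟩
      · exact ⟨Sum.inr j, hy⟩
    · by_cases hxu : x = u
      · subst hxu
        exact ⟨0, 0, 1, by simp, e0, e1.trans (hEu y hy hxy).symm⟩
      by_cases hxv : x = v
      · subst hxv
        exact ⟨0, 1, 0, by simp, e1, e0.trans (hEv y hy hxy).symm⟩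
      by_cases hyu : y = u
      · subst hyu
        exact absurd (hEu x hx (hs _ _ hxy)) hxv
      by_cases hyv : y = v
      · subst hyv
        exact absurd (hEv x hx (hs _ _ hxy)) hxu
      obtain ⟨i, a, b, hab, h1, h2⟩ := hf3 x ((hX' x).2 ⟨hxv, hxu, hx⟩) y
        ((hX' y).2 ⟨hyv, hyu, hy⟩) hxy
      exact ⟨i.succ, a, b, hab, h1, h2⟩

/-! ### Conclusion -/

/-- The structure of graphs without the minor whose spectral radius is as large as that of a
complete bipartite graph with `r - 3` vertices on one side. -/
theorem exists_dominating_set_of_minorFree {r : ℕ} (hr : 4 ≤ r) {H : SimpleGraph (Fin r)}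
    {c p q : Fin r} (hcp : c ≠ p) (hcq : c ≠ q) (hpq : p ≠ q) (hH : ¬ H.Adj p q) :
    ∃ N : ℕ, ∀ (V : Type*) [Fintype V], N ≤ Fintype.card V → ∀ G : SimpleGraph V,
      MinorFree H G → √(((r - 3 : ℕ) : ℝ) * (Fintype.card V - (r - 3 : ℕ) : ℕ)) ≤ lam G →
      ∃ A : Finset V, #A = r - 3 ∧
        (∀ u v w, (∀ a ∈ A, G.Adj a u) → (∀ a ∈ A, G.Adj a v) → (∀ a ∈ A, G.Adj a w) →
          G.Adj u v → G.Adj u w → v = w) ∧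
        (¬ H.Adj c q → ∀ u v, (∀ a ∈ A, G.Adj a u) → (∀ a ∈ A, G.Adj a v) → ¬ G.Adj u v) ∧
        ∀ T : SimpleGraph V, (∀ a ∈ A, ∀ v, v ≠ a → T.Adj a v) →
          (∀ u v, (∀ a ∈ A, G.Adj a u) → (∀ a ∈ A, G.Adj a v) → G.Adj u v → T.Adj u v) →
          lam T ≤ lam G → G = T := by
  set t : ℕ := r - 3 with ht
  set D : ℕ := 2 ^ (r - 1) with hDdef
  have htr : (1 : ℝ) ≤ t := by exact_mod_cast (by omega : 1 ≤ t)
  -- With η = (2 + 4t²)δ one has (D + 2)η = kδ = 1 - 2δ < 1 - δ. Moreover k ≥ 4t gives 2tδ ≤ 1/2, so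
  -- `B` contains at least half of the vertices.
  set k : ℝ := (D + 2) * (2 + 4 * t ^ 2) with hk
  have hDr : (0 : ℝ) ≤ D := Nat.cast_nonneg _
  have hk4 : 4 * (t : ℝ) ≤ k := by nlinarith [mul_nonneg hDr (sq_nonneg (t : ℝ))]
  have hk0 : 0 < k + 2 := by linarith
  set δ : ℝ := 1 / (k + 2) with hδ
  have hδk : (k + 2) * δ = 1 := by rw [hδ]; field_simp
  have hδ0 : 0 < δ := by positivity
  have hδ1 : δ < 1 := by nlinarith
  have htδ : 2 * t * δ ≤ 1 / 2 := by nlinarith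
  obtain ⟨N, hN⟩ := exists_dominating_set t D (r + 4) (by omega) (by positivity) δ hδ0 hδ1
  refine ⟨max N (2 * (r + 4)), ?_⟩
  intro V _ hn G hG hlam
  have hn1 : N ≤ Fintype.card V := (le_max_left _ _).trans hn
  have hn2 : 2 * (r + 4) ≤ Fintype.card V := (le_max_right _ _).trans hn
  have : Nonempty V := Fintype.card_pos_iff.1 (by omega)
  obtain ⟨x, hx0, hx1, hz, hx⟩ := exists_nonneg_eigenvector G
  have hD := degSum_le_of_minorFree (by omega) hG
  have hcast : ((Fintype.card V - t : ℕ) : ℝ) = Fintype.card V - t := Nat.cast_sub (by omega)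
  have hlam2 : (t : ℝ) * (Fintype.card V - t) ≤ lam G ^ 2 := by
    rw [Real.sqrt_le_left ((Real.sqrt_nonneg _).trans hlam), hcast] at hlam
    exact hlam
  have hM : ∀ S : Finset V, #S = t + 1 → #{b | ∀ a ∈ S, G.Adj a b} ≤ r + 4 := by
    intro S hS
    exact (card_common_nbrs_lt (A := S)
      (B := univ.filter fun b => ∀ a ∈ S, G.Adj a b) hG hcp hcq hpq hH (by omega) (card_pos.1 (by omega))
      fun a ha b hb => (mem_filter.1 hb).2 a ha).le
  obtain ⟨A, hAt, hAx, hBc, hxη⟩ := hN V hn1 G x (lam G) hx0 hx1 hz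
    ((Real.sqrt_nonneg _).trans hlam) hx hlam2 hD hM
  set B : Finset V := univ.filter fun b => ∀ a ∈ A, G.Adj a b with hB
  have hAB : ∀ a ∈ A, ∀ b ∈ B, G.Adj a b := fun a ha b hb => (mem_filter.1 hb).2 a ha
  have hmB : ∀ v, (∀ a ∈ A, G.Adj a v) → v ∈ B := fun v hv => mem_filter.2 ⟨mem_univ v, hv⟩
  have hBr : r + 4 ≤ #B := by
    have h1 : (2 * (r + 4) : ℝ) ≤ Fintype.card V := by exact_mod_cast hn2
    have h2 : (r + 4 : ℝ) ≤ #B := by nlinarith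
    exact_mod_cast h2
  have hAr : r ≤ #A + 3 := by omega
  refine ⟨A, hAt, fun u v w hu hv hw huv huw => ?_, fun hH' u v hu hv => ?_,
    fun T hTA hTB hT => ?_⟩
  · exact common_nbrs_degree_le_one hG hcp hcq hpq hH hAr hAB hBr (hmB u hu) (hmB v hv)
      (hmB w hw) huv huw
  · exact common_nbrs_independent hG hcp hcq hpq hH hH' hAr hAB hBr (hmB u hu) (hmB v hv)
  · refine eq_of_lam_le (δ := δ) (η := (2 + 4 * t ^ 2) * δ) hx0 hx hD (card_pos.1 (by omega)) hAx
      hxη (by positivity) ?_ (fun v hv => ?_) hTA hTB hT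
    · rw [← mul_assoc, ← hk]
      linarith
    · exact card_nbrs_in_common_nbrs_le_two hG hcp hcq hpq hH hAr hAB hBr hv

/-- If every graph at least as large in spectral radius is the extremal graph, the extremal graph is
the unique maximizer. -/
theorem le_and_eq_iff_of_iso {V W : Type*} [Fintype V] [Fintype W] [Nonempty V]
    {G : SimpleGraph V} {H : SimpleGraph W} (h : lam H ≤ lam G → Nonempty (G ≃g H)) :
    lam G ≤ lam H ∧ (lam G = lam H ↔ Nonempty (G ≃g H)) := by
  refine ⟨?_, fun e => h e.ge, fun ⟨φ⟩ => lam_eq_of_iso φ⟩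
  by_contra! hlt
  obtain ⟨φ⟩ := h hlt.le
  exact hlt.ne' (lam_eq_of_iso φ)

theorem lam_le_lam_F {r : ℕ} (hr : 4 ≤ r) {H : SimpleGraph (Fin r)} {c p q : Fin r} (hcp : c ≠ p)
    (hcq : c ≠ q) (hpq : p ≠ q) (hH : ¬ H.Adj p q) :
    ∃ N : ℕ, ∀ n : ℕ, N ≤ n → ∀ (V : Type*) [Fintype V], Fintype.card V = n →
      ∀ G : SimpleGraph V, MinorFree H G → lam G ≤ lam (F n (r - 3)) ∧
        (lam G = lam (F n (r - 3)) ↔ Nonempty (G ≃g F n (r - 3))) := by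
  obtain ⟨N, hN⟩ := exists_dominating_set_of_minorFree hr hcp hcq hpq hH
  refine ⟨max N r, ?_⟩
  intro n hn V _ hV G hG
  have hn1 : N ≤ n := (le_max_left _ _).trans hn
  have hn2 : r ≤ n := (le_max_right _ _).trans hn
  have : Nonempty V := Fintype.card_pos_iff.1 (by omega)
  refine le_and_eq_iff_of_iso fun hFG => ?_
  have hcard : Fintype.card ((Fin ((n - (r - 3)) / 2) × Fin 2) ⊕ Fin ((n - (r - 3)) % 2)) =
      n - (r - 3) := by
    simp only [Fintype.card_sum, Fintype.card_prod, Fintype.card_fin]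
    omega
  have hne : Nonempty ((Fin ((n - (r - 3)) / 2) × Fin 2) ⊕ Fin ((n - (r - 3)) % 2)) :=
    Fintype.card_pos_iff.1 (by omega)
  obtain ⟨A, hA, hdeg, -, hT⟩ := hN V (by omega) G hG (le_trans (by
    have h := sqrt_le_lam_join (t := r - 3) (by omega)
      (disjointEdges ((n - (r - 3)) / 2) ⊕g (⊤ : SimpleGraph (Fin ((n - (r - 3)) % 2))))
    rw [hcard] at h
    rwa [hV]) hFG)
  have hAc : #Aᶜ = (n - (r - 3)) / 2 * 2 + (n - (r - 3)) % 2 := by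
    rw [card_compl, hA, hV]; omega
  -- Only edges inside the common neighbourhood are matched; the vertices of `Aᶜ` outside it fill
  -- the remaining places arbitrarily.
  set E : V → V → Prop := fun u v => G.Adj u v ∧ (∀ a ∈ A, G.Adj a u) ∧ ∀ a ∈ A, G.Adj a v
  obtain ⟨f, hf1, hf2, hf3⟩ := exists_matching_extension (E := E)
    (fun u v h => ⟨h.1.symm, h.2.2, h.2.1⟩) (fun u h => G.loopless.irrefl u h.1)
    (fun u v w h h' => hdeg u v w h.2.1 h.2.2 h'.2.2 h.1 h'.1) (by omega) _ Aᶜ hAc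
  have hfi : Function.Injective f := by
    have hs : Function.Surjective fun y => (⟨f y, hf1 y⟩ : (Aᶜ : Finset V)) := by
      rintro ⟨v, hv⟩
      obtain ⟨y, hy⟩ := hf2 v hv
      exact ⟨y, Subtype.ext hy⟩
    have hb := (Fintype.bijective_iff_surjective_and_card _).2 ⟨hs, by
      rw [hcard, Fintype.card_coe, hAc]; omega⟩
    intro y y' h
    exact hb.1 (Subtype.ext h)
  obtain ⟨T, ⟨φ⟩, hTA, hTf⟩ := exists_placement hA
    (disjointEdges ((n - (r - 3)) / 2) ⊕g (⊤ : SimpleGraph (Fin ((n - (r - 3)) % 2)))) hfi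
    fun v => ⟨fun hv => hf2 v (mem_compl.2 hv), fun ⟨y, hy⟩ => hy ▸ mem_compl.1 (hf1 y)⟩
  have hGT : G = T := by
    refine hT T hTA (fun u v hu hv huv => ?_) (le_of_eq_of_le (lam_eq_of_iso φ) hFG)
    have hmem : ∀ w, (∀ a ∈ A, G.Adj a w) → w ∈ Aᶜ := fun w hw =>
      mem_compl.2 fun h => (hw w h).ne rfl
    obtain ⟨i, a, b, hab, rfl, rfl⟩ := hf3 u (hmem u hu) v (hmem v hv) ⟨huv, hu, hv⟩
    exact hTf _ _ (by simp [disjointEdges, boxProd_adj, hab])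
  rw [hGT]
  exact ⟨φ⟩

theorem lam_le_lam_S {r : ℕ} (hr : 4 ≤ r) {H : SimpleGraph (Fin r)} {c p q : Fin r} (hcp : c ≠ p)
    (hcq : c ≠ q) (hpq : p ≠ q) (hH : ¬ H.Adj p q) (hH' : ¬ H.Adj c q) :
    ∃ N : ℕ, ∀ n : ℕ, N ≤ n → ∀ (V : Type*) [Fintype V], Fintype.card V = n →
      ∀ G : SimpleGraph V, MinorFree H G → lam G ≤ lam (S n (r - 3)) ∧
        (lam G = lam (S n (r - 3)) ↔ Nonempty (G ≃g S n (r - 3))) := by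
  obtain ⟨N, hN⟩ := exists_dominating_set_of_minorFree hr hcp hcq hpq hH
  refine ⟨max N r, ?_⟩
  intro n hn V _ hV G hG
  have hn1 : N ≤ n := (le_max_left _ _).trans hn
  have hn2 : r ≤ n := (le_max_right _ _).trans hn
  have : Nonempty V := Fintype.card_pos_iff.1 (by omega)
  refine le_and_eq_iff_of_iso fun hSG => ?_
  have hne : Nonempty (Fin (n - (r - 3))) := ⟨⟨0, by omega⟩⟩
  obtain ⟨A, hA, -, hind, hT⟩ := hN V (by omega) G hG (le_trans (by
    have h := sqrt_le_lam_join (t := r - 3) (by omega) (⊥ : SimpleGraph (Fin (n - (r - 3))))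
    rw [Fintype.card_fin] at h
    rwa [hV]) hSG)
  have hAc : #Aᶜ = n - (r - 3) := by rw [card_compl, hA, hV]
  obtain ⟨T, ⟨φ⟩, hTA, -⟩ := exists_placement hA (⊥ : SimpleGraph (Fin (n - (r - 3))))
    (f := fun i => ((Aᶜ).equivFinOfCardEq hAc).symm i)
    (Subtype.val_injective.comp (Equiv.injective _))
    fun v => ⟨fun hv => ⟨(Aᶜ).equivFinOfCardEq hAc ⟨v, mem_compl.2 hv⟩, by simp⟩,
      fun ⟨i, hi⟩ => hi ▸ mem_compl.1 (((Aᶜ).equivFinOfCardEq hAc).symm i).2⟩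
  have hGT : G = T := hT T hTA (fun u v hu hv huv => absurd huv (hind hH' u v hu hv))
    (le_of_eq_of_le (lam_eq_of_iso φ) hSG)
  rw [hGT]
  exact ⟨φ⟩

end

end MinorSpectral

theorem mainTheorem2 (r : ℕ) (hr : 4 ≤ r) (M : Set (Sym2 (Fin r)))
    (hM : M ⊆ (⊤ : SimpleGraph (Fin r)).edgeSet) :
    (M.Nonempty → (MinorSpectral.edgeInduced ⊤ M hM).IsMatching →
      ∃ N : ℕ, ∀ n : ℕ, N ≤ n → ∀ (V : Type*) [Fintype V], Fintype.card V = n →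
        ∀ G : SimpleGraph V, MinorSpectral.MinorFree (MinorSpectral.completeMinus r M) G →
          MinorSpectral.lam G ≤ MinorSpectral.lam (MinorSpectral.F n (r - 3)) ∧
          (MinorSpectral.lam G = MinorSpectral.lam (MinorSpectral.F n (r - 3)) ↔
            Nonempty (G ≃g MinorSpectral.F n (r - 3)))) ∧
    (¬ (MinorSpectral.edgeInduced ⊤ M hM).IsMatching →
      (MinorSpectral.edgeInduced ⊤ M hM).Connected →
      (MinorSpectral.edgeInduced ⊤ M hM).coe.CliqueFree 3 →
      ∃ N : ℕ, ∀ n : ℕ, N ≤ n → ∀ (V : Type*) [Fintype V], Fintype.card V = n →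
        ∀ G : SimpleGraph V, MinorSpectral.MinorFree (MinorSpectral.completeMinus r M) G →
          MinorSpectral.lam G ≤ MinorSpectral.lam (MinorSpectral.S n (r - 3)) ∧
          (MinorSpectral.lam G = MinorSpectral.lam (MinorSpectral.S n (r - 3)) ↔
            Nonempty (G ≃g MinorSpectral.S n (r - 3)))) := by
  have hadj : ∀ u v, s(u, v) ∈ M → u ≠ v ∧ ¬ (MinorSpectral.completeMinus r M).Adj u v := by
    intro u v h
    have h1 := hM h
    rw [SimpleGraph.mem_edgeSet, SimpleGraph.top_adj] at h1
    refine ⟨h1, fun h2 => ?_⟩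
    rw [MinorSpectral.completeMinus, SimpleGraph.deleteEdges_adj] at h2
    exact h2.2 h
  constructor
  · rintro ⟨e, he⟩ -
    induction e with
    | _ p q =>
    obtain ⟨hpq, hH⟩ := hadj p q he
    -- The centre `c` can be any third vertex.
    obtain ⟨c, -, hc⟩ := Finset.exists_mem_notMem_of_card_lt_card
      (s := ({p, q} : Finset (Fin r))) (t := Finset.univ)
      (lt_of_le_of_lt Finset.card_le_two (by rw [Finset.card_univ, Fintype.card_fin]; omega))
    simp only [Finset.mem_insert, Finset.mem_singleton, not_or] at hc
    exact MinorSpectral.lam_le_lam_F hr hc.1 hc.2 hpq hH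
  · intro hnot _ _
    simp only [SimpleGraph.Subgraph.IsMatching, not_forall] at hnot
    -- Failure of the matching condition at `q` gives two deleted edges at `q`, with other ends `c`
    -- and `p`.
    obtain ⟨q, ⟨e, he, hqe⟩, hq⟩ := hnot
    obtain ⟨c, rfl⟩ := Sym2.mem_iff_exists.1 hqe
    have hex : ∃ p, s(q, p) ∈ M ∧ p ≠ c := by
      by_contra! h
      exact hq ⟨c, he, fun y hy => h y hy⟩
    obtain ⟨p, hp, hpc⟩ := hex
    rw [Sym2.eq_swap] at he hp
    obtain ⟨hcq, hH'⟩ := hadj c q he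
    obtain ⟨hpq, hH⟩ := hadj p q hp
    exact MinorSpectral.lam_le_lam_S hr hpc.symm hcq hpq hH hH'
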